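/- Let $W=(W_t)_{t\ge 0}$ be a standard Brownian motion in the plane $\mathbb{R}^2$ started at the origin, and let $Q_1,Q_2,Q_3,Q_4$ be the four open quadrants in clockwise order, starting with $Q_1=\{(x,y): x>0,\ y>0\}$. For $1\le i\le 4$ let $$\mu(Q_i):=\int_0^1 \mathbf 1_{\{W_t\in Q_i\}}\,dt$$ be the time spent in $Q_i$ up to time $1$. Then for each $k\in\{1,2,3,4\}$ the conditional probability $$\mathbb{P}\big(W_1\in Q_k \,\big|\, \mu(Q_1),\mu(Q_2),\mu(Q_3),\mu(Q_4)\big)$$ is not almost surely equal to $\mu(Q_k)$. Moreover, for $\varepsilon>0$ let $A_\varepsilon$ be the event that $\mu(Q_2)$, $\mu(Q_3)$ and $\mu(Q_4)$ all lie in $[\varepsilon,2\varepsilon]$. There are absolute constants $C>0$ and $\varepsilon_0\in(0,1)$ such that for all $0<\varepsilon<\varepsilon_0$ one has $\mathbb{P}(A_\varepsilon)>0$ and $$\mathbb{P}(W_1\in Q_3 \mid A_\varepsilon)\le C\,\varepsilon^2\,[\log(1/\varepsilon)]^3 .$$ -/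

import Mathlib

open MeasureTheory ProbabilityTheory Set
open scoped NNReal

/-- `W` is a standard planar Brownian motion under `P`: its two coordinate processes are
independent standard real Brownian motions, so that `W` starts almost surely at the origin and
has almost surely continuous paths. Joint measurability in time and `ω` (automatic if every path
is continuous) makes the occupation times below random variables. -/
structure IsPlanarBrownian {Ω : Type*} [MeasurableSpace Ω]
    (W : ℝ≥0 → Ω → EuclideanSpace ℝ (Fin 2)) (P : Measure Ω) : Prop where
  measurable : Measurable (Function.uncurry W)
  coord : ∀ j : Fin 2, IsBrownianReal (fun t ω => W t ω j) P
  indep : IndepFun (fun ω (t : ℝ≥0) => W t ω 0) (fun ω (t : ℝ≥0) => W t ω 1) P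

/-- The four open quadrants of the plane in clockwise order, starting with the positive one.
The index `i : Fin 4` stands for the quadrant `Q_{i+1}`. -/
def quadrant : Fin 4 → Set (EuclideanSpace ℝ (Fin 2)) :=
  ![{x | 0 < x 0 ∧ 0 < x 1},
    {x | 0 < x 0 ∧ x 1 < 0},
    {x | x 0 < 0 ∧ x 1 < 0},
    {x | x 0 < 0 ∧ 0 < x 1}]

/-- The time spent in the quadrant `i` up to time `1`. -/
noncomputable def occTime {Ω : Type*} (W : ℝ≥0 → Ω → EuclideanSpace ℝ (Fin 2))
    (i : Fin 4) (ω : Ω) : ℝ :=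
  ∫ t in (0 : ℝ)..1, (quadrant i).indicator (fun _ => (1 : ℝ)) (W t.toNNReal ω)

/-- The σ-field generated by the four occupation times. -/
noncomputable abbrev occSigma {Ω : Type*} (W : ℝ≥0 → Ω → EuclideanSpace ℝ (Fin 2)) :
    MeasurableSpace Ω :=
  MeasurableSpace.comap (fun ω (i : Fin 4) => occTime W i ω) MeasurableSpace.pi

/-- The event that the times spent in the quadrants `Q_2`, `Q_3`, `Q_4` all lie in `[ε, 2ε]`. -/
def smallTimes {Ω : Type*} (W : ℝ≥0 → Ω → EuclideanSpace ℝ (Fin 2)) (ε : ℝ) : Set Ω :=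
  {ω | ∀ i : Fin 4, i ≠ 0 → occTime W i ω ∈ Icc ε (2 * ε)}

theorem measurableSet_quadrant (i : Fin 4) : MeasurableSet (quadrant i) := by
  have h (j : Fin 2) : Measurable fun x : EuclideanSpace ℝ (Fin 2) => x j := by fun_prop
  fin_cases i
  · exact (measurableSet_lt measurable_const (h 0)).inter (measurableSet_lt measurable_const (h 1))
  · exact (measurableSet_lt measurable_const (h 0)).inter (measurableSet_lt (h 1) measurable_const)
  · exact (measurableSet_lt (h 0) measurable_const).inter (measurableSet_lt (h 1) measurable_const)
  · exact (measurableSet_lt (h 0) measurable_const).inter (measurableSet_lt measurable_const (h 1))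

/-- The occupation times are random variables. -/
theorem IsPlanarBrownian.measurable_occTime {Ω : Type*} [MeasurableSpace Ω]
    {W : ℝ≥0 → Ω → EuclideanSpace ℝ (Fin 2)} {P : Measure Ω} (hW : IsPlanarBrownian W P)
    (i : Fin 4) : Measurable (occTime W i) := by
  have h2 : Measurable fun p : Ω × ℝ => W p.2.toNNReal p.1 :=
    hW.measurable.comp (Measurable.prodMk (measurable_real_toNNReal.comp measurable_snd)
      measurable_fst)
  have h : Measurable fun p : Ω × ℝ =>
      (quadrant i).indicator (fun _ => (1 : ℝ)) (W p.2.toNNReal p.1) :=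
    (measurable_const.indicator (measurableSet_quadrant i)).comp h2
  have h3 := (StronglyMeasurable.integral_prod_right' (ν := volume.restrict (Ioc (0 : ℝ) 1))
    h.stronglyMeasurable).measurable
  have h4 : occTime W i = fun ω => ∫ t in Ioc (0 : ℝ) 1,
      (quadrant i).indicator (fun _ => (1 : ℝ)) (W t.toNNReal ω) := by
    funext ω
    exact intervalIntegral.integral_of_le zero_le_one
  rw [h4]
  exact h3

/-- The occupation times generate a sub-σ-field of that of the probability space. -/
theorem IsPlanarBrownian.occSigma_le {Ω : Type*} [mΩ : MeasurableSpace Ω]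
    {W : ℝ≥0 → Ω → EuclideanSpace ℝ (Fin 2)} {P : Measure Ω} (hW : IsPlanarBrownian W P) :
    occSigma W ≤ mΩ :=
  (measurable_pi_lambda _ hW.measurable_occTime).comap_le

open Filter Topology
open scoped ENNReal

/-- If every sublevel set `{f ≤ f s}` with `s ∈ S` has small measure inside `S`, then `S` has small
measure. -/
theorem volume_le_two_mul_of_forall_sublevel_le {S : Set ℝ} (hS : MeasurableSet S)
    (hfin : volume S ≠ ∞) {f : ℝ → ℝ} (hf : Measurable f) {c : ℝ≥0∞}
    (h : ∀ s ∈ S, volume (S ∩ {t | f t ≤ f s}) ≤ c) : volume S ≤ 2 * c := by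
  set A : Set (ℝ × ℝ) := (S ×ˢ S) ∩ {p | f p.2 ≤ f p.1} with hA
  set B : Set (ℝ × ℝ) := (S ×ˢ S) ∩ {p | f p.1 ≤ f p.2} with hB
  have hAm : MeasurableSet A := (hS.prod hS).inter
    (measurableSet_le (hf.comp measurable_snd) (hf.comp measurable_fst))
  have hBm : MeasurableSet B := (hS.prod hS).inter
    (measurableSet_le (hf.comp measurable_fst) (hf.comp measurable_snd))
  have key : ∀ s, S.indicator (fun s => volume (S ∩ {t | f t ≤ f s})) s ≤
      S.indicator (fun _ => c) s := fun s => by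
    by_cases hs : s ∈ S
    · simpa [hs] using h s hs
    · simp [hs]
  have hA1 : (volume.prod volume) A ≤ c * volume S := by
    rw [Measure.prod_apply hAm]
    calc ∫⁻ s, volume (Prod.mk s ⁻¹' A)
        = ∫⁻ s, S.indicator (fun s => volume (S ∩ {t | f t ≤ f s})) s := by
          refine lintegral_congr fun s => ?_
          by_cases hs : s ∈ S
          · rw [indicator_of_mem hs]; congr 1; ext t; simp [hA, hs]
          · rw [indicator_of_notMem hs]
            rw [show Prod.mk s ⁻¹' A = ∅ by ext t; simp [hA, hs]]; simp
      _ ≤ ∫⁻ s, S.indicator (fun _ => c) s := lintegral_mono key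
      _ = c * volume S := lintegral_indicator_const hS c
  have hB1 : (volume.prod volume) B ≤ c * volume S := by
    rw [Measure.prod_apply_symm hBm]
    calc ∫⁻ s, volume ((fun t => (t, s)) ⁻¹' B)
        = ∫⁻ s, S.indicator (fun s => volume (S ∩ {t | f t ≤ f s})) s := by
          refine lintegral_congr fun s => ?_
          by_cases hs : s ∈ S
          · rw [indicator_of_mem hs]; congr 1; ext t; simp [hB, hs]
          · rw [indicator_of_notMem hs]
            rw [show (fun t => (t, s)) ⁻¹' B = ∅ by ext t; simp [hB, hs]]; simp
      _ ≤ ∫⁻ s, S.indicator (fun _ => c) s := lintegral_mono key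
      _ = c * volume S := lintegral_indicator_const hS c
  have hsq : volume S * volume S ≤ (2 * c) * volume S := by
    rw [← Measure.prod_prod]
    calc (volume.prod volume) (S ×ˢ S) ≤ (volume.prod volume) (A ∪ B) := by
          refine measure_mono fun p hp => ?_
          rcases le_total (f p.2) (f p.1) with h | h
          · exact Or.inl ⟨hp, h⟩
          · exact Or.inr ⟨hp, h⟩
      _ ≤ _ := measure_union_le _ _
      _ ≤ c * volume S + c * volume S := add_le_add hA1 hB1
      _ = _ := by ring
  by_cases h0 : volume S = 0
  · simp [h0]
  · exact (ENNReal.mul_le_mul_iff_left h0 hfin).1 hsq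

/-- The time in `(0, T]` which the path `x` spends in the nonpositive half-line. -/
noncomputable def timeNonpos (T : ℝ) (x : ℝ≥0 → ℝ) : ℝ≥0∞ :=
  ∫⁻ t in Ioc 0 T, (Iic (0 : ℝ)).indicator 1 (x t.toNNReal)

/-- A decreasing sequence of continuous functions with limit the indicator of `(-∞, 0]`. -/
noncomputable def cutoff (m : ℕ) (y : ℝ) : ℝ≥0∞ := ENNReal.ofReal (1 - m * max y 0)

theorem continuous_cutoff (m : ℕ) : Continuous (cutoff m) := by
  unfold cutoff
  exact ENNReal.continuous_ofReal.comp (by fun_prop)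

theorem cutoff_le_one (m : ℕ) (y : ℝ) : cutoff m y ≤ 1 := by
  unfold cutoff
  rw [← ENNReal.ofReal_one]
  apply ENNReal.ofReal_le_ofReal
  have : 0 ≤ (m : ℝ) * max y 0 := by positivity
  linarith

theorem tendsto_cutoff (y : ℝ) :
    Tendsto (fun m => cutoff m y) atTop (𝓝 ((Iic (0 : ℝ)).indicator 1 y)) := by
  by_cases hy : y ≤ 0
  · simp [cutoff, hy]
  · push Not at hy
    obtain ⟨N, hN⟩ := exists_nat_gt (1 / y)
    rw [indicator_of_notMem (by simpa using hy)]
    refine tendsto_const_nhds.congr' ?_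
    filter_upwards [eventually_ge_atTop N] with m hm
    symm
    rw [cutoff, ENNReal.ofReal_eq_zero, max_eq_left hy.le]
    have h1 : (N : ℝ) ≤ m := by exact_mod_cast hm
    rw [div_lt_iff₀ hy] at hN
    nlinarith

/-- The largest multiple of `1 / n` below `t`. -/
noncomputable def gridFloor (n : ℕ) (t : ℝ) : ℝ≥0 := (⌊t * n⌋₊ : ℝ≥0) / n

theorem tendsto_gridFloor {t : ℝ} (ht : 0 ≤ t) :
    Tendsto (fun n => gridFloor n t) atTop (𝓝 t.toNNReal) := by
  rw [← NNReal.tendsto_coe]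
  have := (tendsto_nat_floor_mul_div_atTop ht).comp tendsto_natCast_atTop_atTop
  simpa [gridFloor, Function.comp_def, ht] using this

/-- A functional of the values of a path which agrees with `timeNonpos` on continuous paths and
which, unlike the latter, is measurable for the product `σ`-algebra. -/
noncomputable def gridTimeNonpos (T : ℝ) (x : ℝ≥0 → ℝ) : ℝ≥0∞ :=
  limsup (fun m => limsup
    (fun n => ∫⁻ t in Ioc 0 T, cutoff m (x (gridFloor n t))) atTop) atTop

theorem measurable_eval_gridFloor (n : ℕ) :
    Measurable fun p : (ℝ≥0 → ℝ) × ℝ => p.1 (gridFloor n p.2) := by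
  have h1 : Measurable fun p : (ℝ≥0 → ℝ) × ℕ => p.1 ((p.2 : ℝ≥0) / n) :=
    measurable_from_prod_countable_left fun k =>
      measurable_pi_apply (X := fun _ : ℝ≥0 => ℝ) ((k : ℝ≥0) / n)
  have h2 : Measurable fun p : (ℝ≥0 → ℝ) × ℝ => (p.1, ⌊p.2 * n⌋₊) :=
    measurable_fst.prodMk (Nat.measurable_floor.comp (measurable_snd.mul_const (n : ℝ)))
  exact h1.comp h2

theorem measurable_cutoff_gridFloor (m n : ℕ) :
    Measurable fun p : (ℝ≥0 → ℝ) × ℝ => cutoff m (p.1 (gridFloor n p.2)) :=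
  (continuous_cutoff m).measurable.comp (measurable_eval_gridFloor n)

theorem measurable_gridTimeNonpos (T : ℝ) : Measurable (gridTimeNonpos T) :=
  Measurable.limsup fun m => Measurable.limsup fun n =>
    (measurable_cutoff_gridFloor m n).lintegral_prod_right'

theorem tendsto_lintegral_cutoff_gridFloor {x : ℝ≥0 → ℝ} (hx : Continuous x) (T : ℝ) (m : ℕ) :
    Tendsto (fun n => ∫⁻ t in Ioc 0 T, cutoff m (x (gridFloor n t))) atTop
      (𝓝 (∫⁻ t in Ioc 0 T, cutoff m (x t.toNNReal))) := by
  refine tendsto_lintegral_of_dominated_convergence (fun _ => 1) (fun n => ?_)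
    (fun n => ae_of_all _ fun t => cutoff_le_one _ _) (by simp) ?_
  · exact (measurable_cutoff_gridFloor m n).comp (measurable_prodMk_left (x := x))
  · filter_upwards [ae_restrict_mem measurableSet_Ioc] with t ht
    exact (((continuous_cutoff m).comp hx).tendsto _).comp (tendsto_gridFloor ht.1.le)

theorem tendsto_lintegral_cutoff {x : ℝ≥0 → ℝ} (hx : Continuous x) (T : ℝ) :
    Tendsto (fun m => ∫⁻ t in Ioc 0 T, cutoff m (x t.toNNReal)) atTop
      (𝓝 (timeNonpos T x)) := by
  refine tendsto_lintegral_of_dominated_convergence (fun _ => 1) (fun m => ?_)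
    (fun m => ae_of_all _ fun t => cutoff_le_one _ _) (by simp)
    (ae_of_all _ fun t => tendsto_cutoff _)
  exact ((continuous_cutoff m).comp (hx.comp continuous_real_toNNReal)).measurable

theorem gridTimeNonpos_eq {x : ℝ≥0 → ℝ} (hx : Continuous x) (T : ℝ) :
    gridTimeNonpos T x = timeNonpos T x := by
  unfold gridTimeNonpos
  simp_rw [fun m => (tendsto_lintegral_cutoff_gridFloor hx T m).limsup_eq]
  exact (tendsto_lintegral_cutoff hx T).limsup_eq

theorem timeNonpos_mono (x : ℝ≥0 → ℝ) : Monotone fun T => timeNonpos T x := fun _ _ h =>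
  lintegral_mono_set (Ioc_subset_Ioc_right h)

theorem timeNonpos_eq_volume {x : ℝ≥0 → ℝ} (hx : Measurable x) (T : ℝ) :
    timeNonpos T x = volume (Ioc 0 T ∩ {t | x t.toNNReal ≤ 0}) := by
  have hm : MeasurableSet {t : ℝ | x t.toNNReal ≤ 0} :=
    measurableSet_le (hx.comp measurable_real_toNNReal) measurable_const
  have : (fun t : ℝ => (Iic (0 : ℝ)).indicator (1 : ℝ → ℝ≥0∞) (x t.toNNReal)) =
      {t : ℝ | x t.toNNReal ≤ 0}.indicator 1 := by
    ext t; simp [indicator]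
  rw [timeNonpos, this, lintegral_indicator_one hm, Measure.restrict_apply hm, inter_comm]

/-- A real Brownian motion which is jointly measurable in time and `ω`. -/
structure IsMeasurableBrownian {Ω : Type*} [MeasurableSpace Ω] (X : ℝ≥0 → Ω → ℝ)
    (P : Measure Ω) : Prop where
  measurable_uncurry : Measurable (Function.uncurry X)
  isBrownian : IsBrownianReal X P

namespace IsMeasurableBrownian

variable {Ω : Type*} [MeasurableSpace Ω] {X Y : ℝ≥0 → Ω → ℝ} {P : Measure Ω}

theorem measurable_comp (hX : IsMeasurableBrownian X P) {α : Type*} [MeasurableSpace α]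
    {f : α → ℝ≥0} {g : α → Ω} (hf : Measurable f) (hg : Measurable g) :
    Measurable fun a => X (f a) (g a) :=
  hX.measurable_uncurry.comp (hf.prodMk hg)

theorem measurable_eval (hX : IsMeasurableBrownian X P) (t : ℝ≥0) : Measurable (X t) :=
  hX.measurable_comp measurable_const measurable_id

theorem measurable_path (hX : IsMeasurableBrownian X P) (ω : Ω) : Measurable (X · ω) :=
  hX.measurable_comp measurable_id measurable_const

theorem measurable_process (hX : IsMeasurableBrownian X P) :
    Measurable fun ω t => X t ω :=
  measurable_pi_lambda _ hX.measurable_eval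

theorem isProbabilityMeasure (hX : IsMeasurableBrownian X P) : IsProbabilityMeasure P :=
  hX.isBrownian.isGaussianProcess.isProbabilityMeasure

theorem neg (hX : IsMeasurableBrownian X P) : IsMeasurableBrownian (-X) P :=
  ⟨hX.measurable_uncurry.neg, hX.isBrownian.neg⟩

theorem smul (hX : IsMeasurableBrownian X P) {c : ℝ≥0} (hc : c ≠ 0) :
    IsMeasurableBrownian (fun t ω => (√c)⁻¹ * X (c * t) ω) P :=
  ⟨(hX.measurable_comp (measurable_fst.const_mul c) measurable_snd).const_mul _,
    hX.isBrownian.smul hc⟩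

theorem shift (hX : IsMeasurableBrownian X P) (s : ℝ≥0) :
    IsMeasurableBrownian (fun t ω => X (s + t) ω - X s ω) P :=
  ⟨(hX.measurable_comp (measurable_fst.const_add s) measurable_snd).sub
    (hX.measurable_comp measurable_const measurable_snd), hX.isBrownian.shift s⟩

/-- Reversing the path of a Brownian motion on `[0, s]`, and continuing it with the original
increments, gives a Brownian motion. -/
theorem reverse (hX : IsMeasurableBrownian X P) (s : ℝ≥0) :
    IsMeasurableBrownian (fun t ω => X (s - t) ω + X (max t s) ω - 2 * X s ω) P := by
  classical
  have hP := hX.isProbabilityMeasure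
  have hg := hX.isBrownian.isGaussianProcess
  refine ⟨((hX.measurable_comp (measurable_const.sub measurable_fst) measurable_snd).add
    (hX.measurable_comp (measurable_fst.max measurable_const) measurable_snd)).sub
    ((hX.measurable_comp measurable_const measurable_snd).const_mul 2), ?_, ?_⟩
  · have hm : ∀ t, MemLp (X t) 2 P := fun t => (hg.hasGaussianLaw_eval t).memLp_two
    have hi : ∀ t, Integrable (X t) P := fun t => (hg.hasGaussianLaw_eval t).integrable
    refine IsGaussianProcess.isPreBrownianReal_of_covariance ?_ (fun t => ?_) fun t u htu => ?_
    · refine hg.of_isGaussianProcess fun t => ⟨{s - t, max t s, s},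
        { toFun := fun x => x ⟨s - t, by simp⟩ + x ⟨max t s, by simp⟩ - 2 * x ⟨s, by simp⟩
          map_add' := fun x y => by simp; ring
          map_smul' := fun c x => by simp; ring }, by simp⟩
    · have h4 : Integrable (fun ω => X (s - t) ω + X (max t s) ω) P := (hi _).add (hi _)
      rw [integral_sub h4 ((hi _).const_mul 2), integral_add (hi _) (hi _), integral_const_mul]
      have := hX.isBrownian.integral_eval
      simp [this]
    · have hc := fun a b => hX.isBrownian.covariance_fun_eval a b
      have h2 : MemLp (fun ω => 2 * X s ω) 2 P := (hm s).const_mul 2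
      have h3 : ∀ t, MemLp (fun ω => X (s - t) ω + X (max t s) ω) 2 P :=
        fun t => (hm _).add (hm _)
      have h5 : MemLp (fun ω => X (s - u) ω + X (max u s) ω - 2 * X s ω) 2 P := (h3 u).sub h2
      have key : (min (s - t) (s - u) : ℝ≥0) + (min (s - t) (max u s) : ℝ≥0) +
          ((min (max t s) (s - u) : ℝ≥0) + (min (max t s) (max u s) : ℝ≥0)) -
          2 * ((min (s - t) s : ℝ≥0) + (min (max t s) s : ℝ≥0)) -
          (2 * ((min s (s - u) : ℝ≥0) + (min s (max u s) : ℝ≥0)) - 2 * (2 * (s : ℝ))) =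
          ((t : ℝ≥0) : ℝ) := by
        have e1 : min (s - t) (s - u) = s - u := min_eq_right (tsub_le_tsub_left htu s)
        have e2 : min (s - t) (max u s) = s - t := min_eq_left (tsub_le_self.trans (le_max_right _ _))
        have e3 : min (max t s) (s - u) = s - u :=
          min_eq_right (tsub_le_self.trans (le_max_right _ _))
        have e4 : min (max t s) (max u s) = max t s := min_eq_left (max_le_max_right s htu)
        have e5 : min (s - t) s = s - t := min_eq_left tsub_le_self
        have e6 : min (max t s) s = s := min_eq_right (le_max_right _ _)
        have e7 : min s (s - u) = s - u := min_eq_right tsub_le_self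
        have e8 : min s (max u s) = s := min_eq_left (le_max_right _ _)
        rw [e1, e2, e3, e4, e5, e6, e7, e8]
        rcases le_total t s with h | h
        · rw [max_eq_right h, NNReal.coe_sub h]; ring
        · rw [max_eq_left h, tsub_eq_zero_of_le h]; push_cast; ring
      have hl : ∀ a b c, MemLp c 2 P → cov[fun ω => X a ω + X b ω, c; P] =
          cov[fun ω => X a ω, c; P] + cov[fun ω => X b ω, c; P] :=
        fun a b c h => covariance_add_left (hm a) (hm b) h
      have hr : ∀ a b c, MemLp c 2 P → cov[c, fun ω => X a ω + X b ω; P] =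
          cov[c, fun ω => X a ω; P] + cov[c, fun ω => X b ω; P] :=
        fun a b c h => covariance_add_right h (hm a) (hm b)
      rw [← key, covariance_fun_sub_left (h3 t) h2 h5,
        covariance_fun_sub_right (h3 t) (h3 u) h2, covariance_fun_sub_right h2 (h3 u) h2,
        hl _ _ _ (h3 u), hl _ _ _ h2, hr _ _ _ (hm _), hr _ _ _ (hm _), hr _ _ _ h2]
      simp only [covariance_const_mul_left, covariance_const_mul_right, hc]
      simp only [min_self]
      ring
  · filter_upwards [hX.isBrownian.cont] with ω h
    fun_prop

theorem measure_mem_eq (hX : IsMeasurableBrownian X P) (hY : IsMeasurableBrownian Y P)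
    {G : Set (ℝ≥0 → ℝ)} (hG : MeasurableSet G) :
    P {ω | (fun t => X t ω) ∈ G} = P {ω | (fun t => Y t ω) ∈ G} := by
  have hP := hX.isProbabilityMeasure
  have h : P.map (fun ω t => X t ω) = P.map (fun ω t => Y t ω) := by
    rw [map_eq_iff_forall_finset_map_restrict_eq hX.measurable_process.aemeasurable
      hY.measurable_process.aemeasurable]
    intro I
    rw [(hX.isBrownian.hasLaw I).map_eq, (hY.isBrownian.hasLaw I).map_eq]
  have h2 := congrArg (fun μ => μ G) h
  simp only [Measure.map_apply hX.measurable_process hG,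
    Measure.map_apply hY.measurable_process hG] at h2
  exact h2

theorem timeNonpos_ae_eq (hX : IsMeasurableBrownian X P) (T : ℝ) :
    ∀ᵐ ω ∂P, timeNonpos T (X · ω) = gridTimeNonpos T (X · ω) := by
  filter_upwards [hX.isBrownian.cont] with ω h using (gridTimeNonpos_eq h T).symm

/-- The joint law of a value and of the time spent in the nonpositive half-line is the same for
all Brownian motions. -/
theorem measure_timeNonpos_eq (hX : IsMeasurableBrownian X P) (hY : IsMeasurableBrownian Y P)
    (T : ℝ) (u : ℝ≥0) (δ : ℝ≥0∞) {A : Set ℝ} (hA : MeasurableSet A) :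
    P {ω | timeNonpos T (X · ω) ≤ δ ∧ X u ω ∈ A} =
      P {ω | timeNonpos T (Y · ω) ≤ δ ∧ Y u ω ∈ A} := by
  have hG : MeasurableSet {x : ℝ≥0 → ℝ | gridTimeNonpos T x ≤ δ ∧ x u ∈ A} :=
    (measurableSet_le (measurable_gridTimeNonpos T) measurable_const).inter
      (hA.preimage (measurable_pi_apply u))
  have aux : ∀ {Z : ℝ≥0 → Ω → ℝ}, IsMeasurableBrownian Z P →
      P {ω | timeNonpos T (Z · ω) ≤ δ ∧ Z u ω ∈ A} =
        P {ω | (fun t => Z t ω) ∈ {x : ℝ≥0 → ℝ | gridTimeNonpos T x ≤ δ ∧ x u ∈ A}} :=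
    fun {Z} hZ => by
      refine measure_congr (Filter.eventuallyEq_set.2 ?_)
      filter_upwards [hZ.timeNonpos_ae_eq T] with ω h
      simp only [h]
  rw [aux hX, aux hY, hX.measure_mem_eq hY hG]

theorem measure_timeNonpos_le_eq (hX : IsMeasurableBrownian X P) (hY : IsMeasurableBrownian Y P)
    (T : ℝ) (δ : ℝ≥0∞) :
    P {ω | timeNonpos T (X · ω) ≤ δ} = P {ω | timeNonpos T (Y · ω) ≤ δ} := by
  simpa using hX.measure_timeNonpos_eq hY T 0 δ (A := univ) MeasurableSet.univ

/-- The times spent in the nonpositive half-line by the reversed path and by the shifted path are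
independent. -/
theorem measure_past_inter_future (hX : IsMeasurableBrownian X P) (s : ℝ≥0) (δ : ℝ≥0∞) :
    P ({ω | timeNonpos s (fun t => X (s - t) ω - X s ω) ≤ δ} ∩
        {ω | timeNonpos 1 (fun t => X (s + t) ω - X s ω) ≤ δ}) =
      P {ω | timeNonpos s (fun t => X (s - t) ω - X s ω) ≤ δ} *
        P {ω | timeNonpos 1 (fun t => X (s + t) ω - X s ω) ≤ δ} := by
  let ψ : (Iic s → ℝ) → (ℝ≥0 → ℝ) := fun y t => y ⟨s - t, mem_Iic.2 tsub_le_self⟩ - y ⟨s, self_mem_Iic⟩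
  have hψ : Measurable ψ := measurable_pi_lambda _ fun t =>
    (measurable_pi_apply _).sub (measurable_pi_apply _)
  have hind := (hX.isBrownian.indepFun_shift s).symm.comp
    ((measurable_gridTimeNonpos s).comp hψ) (measurable_gridTimeNonpos 1)
  have h1 : ∀ᵐ ω ∂P, timeNonpos s (fun t => X (s - t) ω - X s ω) =
      ((gridTimeNonpos s ∘ ψ) ∘ fun ω (t : Iic s) => X t ω) ω := by
    filter_upwards [hX.isBrownian.cont] with ω h
    exact (gridTimeNonpos_eq (by fun_prop) _).symm
  have h2 : ∀ᵐ ω ∂P, timeNonpos 1 (fun t => X (s + t) ω - X s ω) =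
      ((gridTimeNonpos 1) ∘ fun ω t => X (s + t) ω - X s ω) ω := by
    filter_upwards [hX.isBrownian.cont] with ω h
    exact (gridTimeNonpos_eq (by fun_prop) _).symm
  have := (hind.congr (EventuallyEq.symm h1) (EventuallyEq.symm h2)).measure_inter_preimage_eq_mul
    (Iic δ) (Iic δ) measurableSet_Iic measurableSet_Iic
  exact this

end IsMeasurableBrownian

/-- The time spent below level `x s` is at most the sum of the times spent below this level before
and after time `s`. -/
theorem volume_sublevel_le_past_add_future {x : ℝ≥0 → ℝ} (hx : Measurable x) (s : ℝ≥0) :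
    volume (Ioc (0 : ℝ) 1 ∩ {t | x t.toNNReal ≤ x s}) ≤
      timeNonpos s (fun t => x (s - t) - x s) + timeNonpos 1 (fun t => x (s + t) - x s) := by
  have hp : Measurable fun t : ℝ≥0 => x (s - t) - x s :=
    (hx.comp (measurable_id.const_sub s)).sub_const _
  have hf : Measurable fun t : ℝ≥0 => x (s + t) - x s :=
    (hx.comp (measurable_id.const_add s)).sub_const _
  rw [timeNonpos_eq_volume hp, timeNonpos_eq_volume hf]
  have hA : MeasurableSet (Ioc (0 : ℝ) s ∩ {t | x (s - t.toNNReal) - x s ≤ 0}) :=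
    measurableSet_Ioc.inter (measurableSet_le (hp.comp measurable_real_toNNReal) measurable_const)
  have hB : MeasurableSet (Ioc (0 : ℝ) 1 ∩ {t | x (s + t.toNNReal) - x s ≤ 0}) :=
    measurableSet_Ioc.inter (measurableSet_le (hf.comp measurable_real_toNNReal) measurable_const)
  rw [← (Measure.measurePreserving_sub_left volume (s : ℝ)).measure_preimage hA.nullMeasurableSet,
    ← (measurePreserving_sub_right volume (s : ℝ)).measure_preimage hB.nullMeasurableSet]
  have h0 : volume {(s : ℝ)} = 0 := Real.volume_singleton
  set A' := (fun t : ℝ => (s : ℝ) - t) ⁻¹' (Ioc (0 : ℝ) s ∩ {t | x (s - t.toNNReal) - x s ≤ 0})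
  set B' := (fun t : ℝ => t - (s : ℝ)) ⁻¹' (Ioc (0 : ℝ) 1 ∩ {t | x (s + t.toNNReal) - x s ≤ 0})
  calc volume (Ioc (0 : ℝ) 1 ∩ {t | x t.toNNReal ≤ x s})
      ≤ volume ((A' ∪ B') ∪ {(s : ℝ)}) := by
        refine measure_mono ?_
        rintro t ⟨⟨ht0, ht1⟩, ht⟩
        rcases lt_trichotomy t s with h | h | h
        · refine Or.inl (Or.inl ⟨⟨by simpa using h, by simpa using ht0.le⟩, ?_⟩)
          have : s - ((s : ℝ) - t).toNNReal = t.toNNReal := by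
            rw [← NNReal.coe_inj, NNReal.coe_sub (by
              rw [← NNReal.coe_le_coe, Real.coe_toNNReal _ (by linarith)]; linarith),
              Real.coe_toNNReal _ (by linarith), Real.coe_toNNReal _ ht0.le]
            ring
          simpa [this] using ht
        · exact Or.inr h
        · refine Or.inl (Or.inr ⟨⟨by simpa using h, ?_⟩, ?_⟩)
          · have := s.2; change t - (s : ℝ) ≤ 1; linarith [NNReal.coe_nonneg s]
          have : s + (t - (s : ℝ)).toNNReal = t.toNNReal := by
            rw [← NNReal.coe_inj, NNReal.coe_add,
              Real.coe_toNNReal _ (by linarith), Real.coe_toNNReal _ ht0.le]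
            ring
          simpa [this] using ht
    _ ≤ volume (A' ∪ B') + volume {(s : ℝ)} := measure_union_le _ _
    _ ≤ volume A' + volume B' := by rw [h0, add_zero]; exact measure_union_le _ _

namespace IsMeasurableBrownian

variable {Ω : Type*} [MeasurableSpace Ω] {X Y : ℝ≥0 → Ω → ℝ} {P : Measure Ω}

theorem measure_past_ge (hX : IsMeasurableBrownian X P) {s : ℝ≥0} (hs : s ≤ 1) (δ : ℝ≥0∞) :
    P {ω | timeNonpos 1 (X · ω) ≤ δ} ≤
      P {ω | timeNonpos s (fun t => X (s - t) ω - X s ω) ≤ δ} := by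
  have h1 : ∀ ω, timeNonpos s (fun t => X (s - t) ω - X s ω) =
      timeNonpos s (fun t => X (s - t) ω + X (max t s) ω - 2 * X s ω) := fun ω => by
    refine setLIntegral_congr_fun measurableSet_Ioc fun t ht => ?_
    have : max t.toNNReal s = s := max_eq_right (Real.toNNReal_le_iff_le_coe.2 ht.2)
    simp only [this]
    congr 1
    ring
  simp_rw [h1]
  rw [(hX.reverse s).measure_timeNonpos_le_eq hX]
  exact measure_mono fun ω hω => (timeNonpos_mono _ (by exact_mod_cast hs)).trans hω

theorem sq_measure_timeNonpos_le (hX : IsMeasurableBrownian X P) {δ : ℝ≥0∞} :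
    P {ω | timeNonpos 1 (X · ω) ≤ δ} ^ 2 ≤ 4 * δ := by
  have hP := hX.isProbabilityMeasure
  set q := P {ω | timeNonpos 1 (X · ω) ≤ δ} with hq
  let E : Set ((Ω × ℝ) × ℝ) :=
    {p | p.2 ∈ Ioc (0 : ℝ) 1 ∧ X p.2.toNNReal p.1.1 ≤ X p.1.2.toNNReal p.1.1}
  have hE : MeasurableSet E := (measurableSet_Ioc.preimage measurable_snd).inter
    (measurableSet_le
      (hX.measurable_comp (measurable_real_toNNReal.comp measurable_snd)
        (measurable_fst.comp measurable_fst))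
      (hX.measurable_comp (measurable_real_toNNReal.comp (measurable_snd.comp measurable_fst))
        (measurable_fst.comp measurable_fst)))
  let D : Set (Ω × ℝ) := {p | p.2 ∈ Ioc (0 : ℝ) 1 ∧ volume (Prod.mk p ⁻¹' E) ≤ 2 * δ}
  have hD : MeasurableSet D := (measurableSet_Ioc.preimage measurable_snd).inter
    (measurableSet_le (measurable_measure_prodMk_left hE) measurable_const)
  have hup : (P.prod volume) D ≤ 4 * δ := by
    rw [Measure.prod_apply hD]
    calc ∫⁻ ω, volume (Prod.mk ω ⁻¹' D) ∂P ≤ ∫⁻ _, 4 * δ ∂P := by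
          refine lintegral_mono fun ω => ?_
          have hsub : Prod.mk ω ⁻¹' D ⊆ Ioc 0 1 := fun s hs => hs.1
          have := volume_le_two_mul_of_forall_sublevel_le (S := Prod.mk ω ⁻¹' D)
            (hD.preimage measurable_prodMk_left)
            ((measure_mono hsub).trans_lt (by simp)).ne
            ((hX.measurable_path ω).comp measurable_real_toNNReal) (c := 2 * δ)
            fun s hs => le_trans (measure_mono (t := Prod.mk (ω, s) ⁻¹' E)
              fun t ht => ⟨hsub ht.1, ht.2⟩) hs.2
          calc volume (Prod.mk ω ⁻¹' D) ≤ _ := this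
            _ = 4 * δ := by rw [← mul_assoc]; norm_num
      _ = 4 * δ := by simp
  refine le_trans ?_ hup
  rw [Measure.prod_apply_symm hD]
  calc q ^ 2 = ∫⁻ s, (Ioc (0 : ℝ) 1).indicator (fun _ => q ^ 2) s := by
        rw [lintegral_indicator_const measurableSet_Ioc]; simp
    _ ≤ _ := by
        refine lintegral_mono fun s => ?_
        by_cases hs : s ∈ Ioc (0 : ℝ) 1
        · rw [indicator_of_mem hs]
          set r := s.toNNReal
          have hr : r ≤ 1 := by simpa [r] using hs.2
          calc q ^ 2 = q * q := sq q
            _ ≤ P {ω | timeNonpos r (fun t => X (r - t) ω - X r ω) ≤ δ} *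
                P {ω | timeNonpos 1 (fun t => X (r + t) ω - X r ω) ≤ δ} := by
              refine mul_le_mul' (hX.measure_past_ge hr δ) ?_
              rw [(hX.shift r).measure_timeNonpos_le_eq hX]
            _ = _ := (hX.measure_past_inter_future r δ).symm
            _ ≤ _ := by
              refine measure_mono fun ω hω => ⟨hs, ?_⟩
              rw [two_mul]
              exact (volume_sublevel_le_past_add_future (hX.measurable_path ω) r).trans
                (add_le_add hω.1 hω.2)
        · rw [indicator_of_notMem hs]; exact zero_le

/-- By scaling, the event `{N ≤ δ / 2, X 1 ≤ 0}`, where `N` is the time spent in the nonpositive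
half-line up to time `1`, is at most as likely as its analogue at a time `s ∈ [1, 2]`. -/
theorem measure_timeNonpos_and_le_scale (hX : IsMeasurableBrownian X P) {s : ℝ≥0} (h1 : 1 ≤ s)
    (h2 : s ≤ 2) (δ : ℝ≥0∞) :
    P {ω | timeNonpos 1 (X · ω) ≤ δ / 2 ∧ X 1 ω ≤ 0} ≤
      P {ω | timeNonpos s (X · ω) ≤ δ ∧ X s ω ≤ 0} := by
  have hs0 : s ≠ 0 := (zero_lt_one.trans_le h1).ne'
  have hs : (0 : ℝ) < s := by positivity
  have hsq : 0 < (√(s : ℝ))⁻¹ := by positivity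
  have := hX.measure_timeNonpos_eq (hX.smul hs0) 1 1 (δ / 2) (measurableSet_Iic (a := (0 : ℝ)))
  simp only [mem_Iic] at this
  rw [this]
  refine measure_mono fun ω hω => ?_
  obtain ⟨ha, hb⟩ := hω
  refine ⟨?_, ?_⟩
  · have hm := hX.measurable_path ω
    have hm' : Measurable fun t : ℝ≥0 => (√(s : ℝ))⁻¹ * X (s * t) ω :=
      (hm.comp (measurable_id.const_mul s)).const_mul _
    rw [timeNonpos_eq_volume hm'] at ha
    rw [timeNonpos_eq_volume hm]
    have he : Ioc (0 : ℝ) 1 ∩ {t | (√(s : ℝ))⁻¹ * X (s * t.toNNReal) ω ≤ 0} =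
        ((s : ℝ) * ·) ⁻¹' (Ioc (0 : ℝ) s ∩ {t | X t.toNNReal ω ≤ 0}) := by
      ext t
      have e1 : (s * t : ℝ).toNNReal = s * t.toNNReal := by
        rw [Real.toNNReal_mul hs.le, Real.toNNReal_coe]
      simp only [mem_inter_iff, mem_Ioc, mem_ofPred_eq, mem_preimage, e1]
      rw [mul_pos_iff_of_pos_left hs, mul_le_iff_le_one_right hs, mul_nonpos_iff]
      simp [hsq.not_ge]
    rw [he, Real.volume_preimage_mul_left hs.ne', abs_of_pos (inv_pos.2 hs)] at ha
    set V := volume (Ioc (0 : ℝ) s ∩ {t | X t.toNNReal ω ≤ 0})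
    calc V = 2 * (ENNReal.ofReal 2⁻¹ * V) := by
          rw [← mul_assoc, ENNReal.ofReal_inv_of_pos (by norm_num)]
          simp [ENNReal.mul_inv_cancel]
      _ ≤ 2 * (ENNReal.ofReal (s : ℝ)⁻¹ * V) := by
          gcongr
          exact_mod_cast h2
      _ ≤ 2 * (δ / 2) := by gcongr
      _ = δ := ENNReal.mul_div_cancel (by norm_num) (by norm_num)
  · simp only [mul_one] at hb
    exact nonpos_of_mul_nonpos_right hb hsq

theorem measure_timeNonpos_and_nonpos_le (hX : IsMeasurableBrownian X P) (δ : ℝ≥0∞) :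
    P {ω | timeNonpos 1 (X · ω) ≤ δ / 2 ∧ X 1 ω ≤ 0} ≤
      2 * δ * P {ω | timeNonpos 1 (X · ω) ≤ δ} := by
  have hP := hX.isProbabilityMeasure
  set a := P {ω | timeNonpos 1 (X · ω) ≤ δ / 2 ∧ X 1 ω ≤ 0} with ha
  let E : Set ((Ω × ℝ) × ℝ) := {p | p.2 ∈ Ioc (0 : ℝ) p.1.2 ∧ X p.2.toNNReal p.1.1 ≤ 0}
  have hE : MeasurableSet E := ((measurableSet_lt measurable_const measurable_snd).inter
    (measurableSet_le measurable_snd (measurable_snd.comp measurable_fst))).inter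
    (measurableSet_le
      (hX.measurable_comp (measurable_real_toNNReal.comp measurable_snd)
        (measurable_fst.comp measurable_fst)) measurable_const)
  have hEv : ∀ ω s, volume (Prod.mk (ω, s) ⁻¹' E) = timeNonpos s (X · ω) := fun ω s => by
    rw [timeNonpos_eq_volume (hX.measurable_path ω)]; rfl
  have hmeas : Measurable fun p : Ω × ℝ => timeNonpos p.2 (X · p.1) := by
    simp_rw [← hEv]
    exact measurable_measure_prodMk_left hE
  let D : Set (Ω × ℝ) := {p | p.2 ∈ Ioc (1 : ℝ) 2 ∧ timeNonpos p.2 (X · p.1) ≤ δ ∧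
    X p.2.toNNReal p.1 ≤ 0}
  have hD : MeasurableSet D := (measurableSet_Ioc.preimage measurable_snd).inter
    ((measurableSet_le hmeas measurable_const).inter (measurableSet_le
      (hX.measurable_comp (measurable_real_toNNReal.comp measurable_snd) measurable_fst)
      measurable_const))
  have hup : (P.prod volume) D ≤ 2 * δ * P {ω | timeNonpos 1 (X · ω) ≤ δ} := by
    have hm1 : MeasurableSet {ω | timeNonpos 1 (X · ω) ≤ δ} :=
      measurableSet_le (hmeas.comp measurable_prodMk_right) measurable_const
    rw [Measure.prod_apply hD, ← lintegral_indicator_const hm1]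
    refine lintegral_mono fun ω => ?_
    have hsub : Prod.mk ω ⁻¹' D ⊆ Ioc 1 2 := fun s hs => hs.1
    by_cases hω : timeNonpos 1 (X · ω) ≤ δ
    · rw [indicator_of_mem (by exact hω)]
      refine volume_le_two_mul_of_forall_sublevel_le (hD.preimage measurable_prodMk_left)
        ((measure_mono hsub).trans_lt (by simp)).ne measurable_id fun s hs => ?_
      refine le_trans ?_ hs.2.1
      rw [timeNonpos_eq_volume (hX.measurable_path ω)]
      exact measure_mono fun t ht => ⟨⟨by linarith [(hsub ht.1).1], ht.2⟩, ht.1.2.2⟩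
    · rw [indicator_of_notMem (by exact hω)]
      have : Prod.mk ω ⁻¹' D = ∅ := by
        ext s
        simp only [mem_empty_iff_false, iff_false]
        exact fun hs => hω ((timeNonpos_mono _ hs.1.1.le).trans hs.2.1)
      simp [this]
  refine le_trans ?_ hup
  rw [Measure.prod_apply_symm hD]
  calc a = ∫⁻ s, (Ioc (1 : ℝ) 2).indicator (fun _ => a) s := by
        rw [lintegral_indicator_const measurableSet_Ioc]; norm_num
    _ ≤ _ := by
        refine lintegral_mono fun s => ?_
        by_cases hs : s ∈ Ioc (1 : ℝ) 2
        · rw [indicator_of_mem hs]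
          have hs' : ((s.toNNReal : ℝ≥0) : ℝ) = s :=
            Real.coe_toNNReal _ (by linarith [hs.1])
          have hle1 : 1 ≤ s.toNNReal := by rw [← NNReal.coe_le_coe, hs']; exact hs.1.le
          have hle2 : s.toNNReal ≤ 2 := by rw [← NNReal.coe_le_coe, hs']; exact hs.2
          refine (hX.measure_timeNonpos_and_le_scale hle1 hle2 δ).trans (measure_mono ?_)
          intro ω hω
          refine ⟨hs, ?_, hω.2⟩
          have := hω.1
          rwa [hs'] at this
        · rw [indicator_of_notMem hs]; exact zero_le

/-- The probability that a Brownian motion is nonpositive at time `1` although it has spent time at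
most `δ` in the nonpositive half-line is `O(δ ^ (3 / 2))`. -/
theorem sq_measure_timeNonpos_and_nonpos_le (hX : IsMeasurableBrownian X P) (δ : ℝ≥0∞) :
    P {ω | timeNonpos 1 (X · ω) ≤ δ ∧ X 1 ω ≤ 0} ^ 2 ≤ 128 * δ ^ 3 := by
  have h := hX.measure_timeNonpos_and_nonpos_le (2 * δ)
  have h2 : 2 * δ / 2 = δ := by
    rw [mul_comm]; exact ENNReal.mul_div_cancel_right (by norm_num) (by norm_num)
  rw [h2] at h
  calc _ ≤ (2 * (2 * δ) * P {ω | timeNonpos 1 (X · ω) ≤ 2 * δ}) ^ 2 := by gcongr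
    _ = 16 * δ ^ 2 * P {ω | timeNonpos 1 (X · ω) ≤ 2 * δ} ^ 2 := by ring
    _ ≤ 16 * δ ^ 2 * (4 * (2 * δ)) := by gcongr; exact hX.sq_measure_timeNonpos_le
    _ = 128 * δ ^ 3 := by ring

end IsMeasurableBrownian

/-- The paths staying in `A` up to time `T`, tested at countably many times. -/
def stayIn (T : ℝ≥0) (A : Set ℝ) : Set (ℝ≥0 → ℝ) :=
  {x | ∀ n, x (min (TopologicalSpace.denseSeq ℝ≥0 n) T) ∈ A}

theorem measurableSet_stayIn (T : ℝ≥0) {A : Set ℝ} (hA : MeasurableSet A) :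
    MeasurableSet (stayIn T A) := by
  have : stayIn T A = ⋂ n, (fun x : ℝ≥0 → ℝ =>
      x (min (TopologicalSpace.denseSeq ℝ≥0 n) T)) ⁻¹' A := by
    ext x; simp [stayIn]
  rw [this]
  exact MeasurableSet.iInter fun n => hA.preimage (measurable_pi_apply _)

theorem mem_of_mem_stayIn {T : ℝ≥0} {A : Set ℝ} (hA : IsClosed A) {x : ℝ≥0 → ℝ}
    (hx : Continuous x) (h : x ∈ stayIn T A) {t : ℝ≥0} (ht : t ≤ T) : x t ∈ A := by
  have hc : IsClosed {t : ℝ≥0 | x (min t T) ∈ A} :=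
    hA.preimage (hx.comp (continuous_id.min continuous_const))
  have := (TopologicalSpace.denseRange_denseSeq ℝ≥0).induction_on
    (p := fun t => x (min t T) ∈ A) t hc h
  rwa [min_eq_left ht] at this

/-- The path `x` stopped at time `s`. -/
def stopPath (s : ℝ≥0) (x : ℝ≥0 → ℝ) (t : ℝ≥0) : ℝ := x (min t s)

/-- The increments of the path `x` after time `s`. -/
def shiftPath (s : ℝ≥0) (x : ℝ≥0 → ℝ) (t : ℝ≥0) : ℝ := x (s + t) - x s

theorem shiftPath_shiftPath (s u : ℝ≥0) (x : ℝ≥0 → ℝ) :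
    shiftPath s (shiftPath u x) = shiftPath (u + s) x := by
  ext t
  simp [shiftPath, add_assoc]

theorem measurable_stopPath (s : ℝ≥0) : Measurable (stopPath s) :=
  measurable_pi_lambda _ fun _ => measurable_pi_apply _

theorem measurable_shiftPath (s : ℝ≥0) : Measurable (shiftPath s) :=
  measurable_pi_lambda _ fun _ => (measurable_pi_apply _).sub (measurable_pi_apply _)

/-- The paths which are in `A` when stopped at time `s`, and whose increments after time `s` are
in `G`. -/
def concatSet (s : ℝ≥0) (A G : Set (ℝ≥0 → ℝ)) : Set (ℝ≥0 → ℝ) :=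
  stopPath s ⁻¹' A ∩ shiftPath s ⁻¹' G

theorem measurableSet_concatSet (s : ℝ≥0) {A G : Set (ℝ≥0 → ℝ)} (hA : MeasurableSet A)
    (hG : MeasurableSet G) : MeasurableSet (concatSet s A G) :=
  (hA.preimage (measurable_stopPath s)).inter (hG.preimage (measurable_shiftPath s))

theorem gaussianReal_Icc_pos (d : ℝ) {v : ℝ≥0} (hv : v ≠ 0) :
    0 < gaussianReal 0 v (Icc (d - 1) (d + 1)) := by
  rw [pos_iff_ne_zero]
  intro h
  have := gaussianReal_absolutelyContinuous' 0 hv h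
  rw [Real.volume_Icc] at this
  norm_num at this

theorem le_gaussianReal_Icc {T : ℝ≥0} (hT : 1 ≤ T) :
    ENNReal.ofReal (2 * ((√(2 * Real.pi))⁻¹ * Real.exp (-1)) / √T) ≤
      gaussianReal 0 T (Icc (-1) 1) := by
  have hT0 : T ≠ 0 := (zero_lt_one.trans_le hT).ne'
  have hT1 : (1 : ℝ) ≤ T := by exact_mod_cast hT
  set c := (√(2 * Real.pi))⁻¹ * Real.exp (-1) / √T with hc
  have hc0 : 0 ≤ c := by positivity
  rw [gaussianReal_apply 0 hT0]
  calc ENNReal.ofReal (2 * ((√(2 * Real.pi))⁻¹ * Real.exp (-1)) / √T)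
      = ∫⁻ _ in Icc (-1 : ℝ) 1, ENNReal.ofReal c := by
        rw [setLIntegral_const, Real.volume_Icc, ← ENNReal.ofReal_mul hc0]
        congr 1
        rw [hc]; ring
    _ ≤ _ := by
        refine setLIntegral_mono (measurable_gaussianPDF 0 T) fun x hx => ?_
        refine ENNReal.ofReal_le_ofReal ?_
        rw [gaussianPDFReal, Real.sqrt_mul (by positivity), mul_inv, hc, div_eq_mul_inv,
          mul_right_comm]
        refine mul_le_mul_of_nonneg_left (Real.exp_le_exp.2 ?_) (by positivity)
        rw [sub_zero, neg_div, neg_le_neg_iff, div_le_one (by positivity)]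
        nlinarith [hx.1, hx.2]

namespace IsMeasurableBrownian

variable {Ω : Type*} [MeasurableSpace Ω] {X : ℝ≥0 → Ω → ℝ} {P : Measure Ω}

theorem measure_eval (hX : IsMeasurableBrownian X P) (t : ℝ≥0) {A : Set ℝ}
    (hA : MeasurableSet A) : P {ω | X t ω ∈ A} = gaussianReal 0 t A := by
  rw [← (hX.isBrownian.hasLaw_eval t).map_eq, Measure.map_apply (hX.measurable_eval t) hA]
  rfl

theorem indepFun_stop_shift (hX : IsMeasurableBrownian X P) (s : ℝ≥0) :
    IndepFun (fun ω => stopPath s (X · ω)) (fun ω => shiftPath s (X · ω)) P := by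
  let ψ : (Iic s → ℝ) → (ℝ≥0 → ℝ) := fun y t => y ⟨min t s, mem_Iic.2 (min_le_right _ _)⟩
  have hψ : Measurable ψ := measurable_pi_lambda _ fun t => measurable_pi_apply _
  exact (hX.isBrownian.indepFun_shift s).symm.comp hψ measurable_id

theorem measure_concatSet (hX : IsMeasurableBrownian X P) (s : ℝ≥0) {A G : Set (ℝ≥0 → ℝ)}
    (hA : MeasurableSet A) (hG : MeasurableSet G) :
    P {ω | (X · ω) ∈ concatSet s A G} =
      P {ω | stopPath s (X · ω) ∈ A} * P {ω | (X · ω) ∈ G} := by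
  rw [← (hX.shift s).measure_mem_eq hX hG]
  exact (hX.indepFun_stop_shift s).measure_inter_preimage_eq_mul _ _ hA hG

theorem half_le_measure_nonpos (hX : IsMeasurableBrownian X P) (t : ℝ≥0) :
    1 ≤ 2 * P {ω | X t ω ≤ 0} := by
  have hP := hX.isProbabilityMeasure
  have h := hX.neg.measure_mem_eq hX (G := {x | x t ≤ 0})
    (measurableSet_le (measurable_pi_apply t) measurable_const)
  have h' : P {ω | 0 ≤ X t ω} = P {ω | X t ω ≤ 0} := by
    simpa using h
  calc (1 : ℝ≥0∞) = P univ := measure_univ.symm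
    _ ≤ P ({ω | X t ω ≤ 0} ∪ {ω | 0 ≤ X t ω}) := measure_mono fun ω _ => le_total (X t ω) 0
    _ ≤ _ := measure_union_le _ _
    _ = _ := by rw [h', two_mul]

/-- **Lévy's maximal inequality** for a Brownian motion at finitely many times. -/
theorem measure_exists_lt_finset_le (hX : IsMeasurableBrownian X P) (I : Finset ℝ≥0) {T : ℝ≥0}
    (hI : ∀ t ∈ I, t ≤ T) (b : ℝ) :
    P {ω | ∃ t ∈ I, X t ω < b} ≤ 2 * P {ω | X T ω < b} := by
  have hP := hX.isProbabilityMeasure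
  let B : ℝ≥0 → Set (ℝ≥0 → ℝ) := fun t => {x | x t < b ∧ ∀ s ∈ I, s < t → b ≤ x s}
  have hB : ∀ t, MeasurableSet (B t) := fun t => by
    have : B t = {x | x t < b} ∩ ⋂ s ∈ I, ⋂ (_ : s < t), {x | b ≤ x s} := by
      ext x; simp [B]
    rw [this]
    exact (measurableSet_lt (measurable_pi_apply t) measurable_const).inter
      (I.measurableSet_biInter fun s _ => MeasurableSet.iInter fun _ =>
        measurableSet_le measurable_const (measurable_pi_apply s))
  let G : ℝ≥0 → Set (ℝ≥0 → ℝ) := fun t => {x | x (T - t) ≤ 0}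
  have hG : ∀ t, MeasurableSet (G t) := fun t =>
    measurableSet_le (measurable_pi_apply _) measurable_const
  let A : ℝ≥0 → Set Ω := fun t => {ω | stopPath t (X · ω) ∈ B t}
  have hmem : ∀ t ω, ω ∈ A t ↔ X t ω < b ∧ ∀ s ∈ I, s < t → b ≤ X s ω := fun t ω => by
    change (X (min t t) ω < b ∧ ∀ s ∈ I, s < t → b ≤ X (min s t) ω) ↔ _
    rw [min_self]
    refine and_congr_right fun _ => forall₃_congr fun s _ hs => ?_
    rw [min_eq_left hs.le]
  have hcm : ∀ t, MeasurableSet {ω | (X · ω) ∈ concatSet t (B t) (G t)} := fun t =>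
    (measurableSet_concatSet t (hB t) (hG t)).preimage hX.measurable_process
  have hdisj : ∀ t ∈ I, ∀ u ∈ I, ∀ ω, ω ∈ A t → ω ∈ A u → t = u := by
    intro t ht u hu ω h1 h2
    rw [hmem] at h1 h2
    rcases lt_trichotomy t u with h | h | h
    · exact absurd h1.1 (h2.2 t ht h).not_gt
    · exact h
    · exact absurd h2.1 (h1.2 u hu h).not_gt
  calc P {ω | ∃ t ∈ I, X t ω < b} ≤ P (⋃ t ∈ I, A t) := by
        refine measure_mono fun ω hω => ?_
        obtain ⟨t, ht, hmin⟩ := (I.filter fun t => X t ω < b).exists_min_image id (by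
          obtain ⟨t, ht, h⟩ := hω; exact ⟨t, by simp [ht, h]⟩)
        rw [Finset.mem_filter] at ht
        refine mem_iUnion₂.2 ⟨t, ht.1, (hmem t ω).2 ⟨ht.2, fun s hs hst => ?_⟩⟩
        by_contra! hlt
        exact hst.not_ge (hmin s (by simp [hs, hlt]))
    _ ≤ ∑ t ∈ I, P (A t) := measure_biUnion_finset_le _ _
    _ ≤ ∑ t ∈ I, 2 * P {ω | (X · ω) ∈ concatSet t (B t) (G t)} := by
        refine Finset.sum_le_sum fun t _ => ?_
        rw [hX.measure_concatSet t (hB t) (hG t), mul_left_comm]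
        exact le_mul_of_one_le_right' (hX.half_le_measure_nonpos _)
    _ = 2 * P (⋃ t ∈ I, {ω | (X · ω) ∈ concatSet t (B t) (G t)}) := by
        rw [← Finset.mul_sum, measure_biUnion_finset _ fun t _ => hcm t]
        intro t ht u hu htu
        exact Set.disjoint_left.2 fun ω h1 h2 => htu (hdisj t ht u hu ω h1.1 h2.1)
    _ ≤ 2 * P {ω | X T ω < b} := by
        gcongr
        refine iUnion₂_subset fun t ht ω hω => ?_
        have h1 := ((hmem t ω).1 hω.1).1
        have h2 : X (t + (T - t)) ω - X t ω ≤ 0 := hω.2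
        rw [add_tsub_cancel_of_le (hI t ht)] at h2
        change X T ω < b
        linarith

theorem measure_notMem_stayIn_Ici_le (hX : IsMeasurableBrownian X P) (T : ℝ≥0) (b : ℝ) :
    P {ω | (X · ω) ∉ stayIn T (Ici b)} ≤ 2 * P {ω | X T ω < b} := by
  classical
  let u : ℕ → ℝ≥0 := fun n => min (TopologicalSpace.denseSeq ℝ≥0 n) T
  have h : {ω | (X · ω) ∉ stayIn T (Ici b)} =
      ⋃ n, {ω | ∃ t ∈ (Finset.range n).image u, X t ω < b} := by
    ext ω
    simp only [stayIn, mem_ofPred_eq, not_forall, mem_Ici, not_le, mem_iUnion, Finset.mem_image,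
      Finset.mem_range]
    constructor
    · rintro ⟨n, hn⟩
      exact ⟨n + 1, u n, ⟨n, n.lt_succ_self, rfl⟩, hn⟩
    · rintro ⟨_, _, ⟨n, _, rfl⟩, hn⟩
      exact ⟨n, hn⟩
  rw [h, Monotone.measure_iUnion]
  · refine iSup_le fun n => hX.measure_exists_lt_finset_le _ (fun t ht => ?_) b
    obtain ⟨k, _, rfl⟩ := Finset.mem_image.1 ht
    exact min_le_right _ _
  · rintro n m hnm ω ⟨t, ht, h⟩
    exact ⟨t, Finset.image_subset_image (Finset.range_mono hnm) ht, h⟩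

theorem measure_lt_neg_eq (hX : IsMeasurableBrownian X P) (T : ℝ≥0) (b : ℝ) :
    P {ω | X T ω < -b} = P {ω | b < X T ω} := by
  have h := hX.neg.measure_mem_eq hX (G := {x | b < x T})
    (measurableSet_lt measurable_const (measurable_pi_apply T))
  rw [← show P {ω | b < -X T ω} = P {ω | b < X T ω} from h]
  simp_rw [lt_neg]

theorem measure_notMem_stayIn_Ici_le_compl (hX : IsMeasurableBrownian X P) (T : ℝ≥0) {b : ℝ}
    (hb : 0 ≤ b) :
    P {ω | (X · ω) ∉ stayIn T (Ici (-b))} ≤ P {ω | X T ω ∈ (Icc (-b) b)ᶜ} := by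
  refine (hX.measure_notMem_stayIn_Ici_le T (-b)).trans_eq ?_
  rw [two_mul]
  nth_rw 2 [hX.measure_lt_neg_eq]
  rw [← measure_union]
  · congr 1
    ext ω
    simp only [mem_union, mem_ofPred_eq, mem_compl_iff, mem_Icc, not_and_or, not_le]
  · refine Set.disjoint_left.2 fun ω h1 h2 => ?_
    simp only [mem_ofPred_eq] at h1 h2
    linarith
  · exact measurableSet_lt measurable_const (hX.measurable_eval T)

theorem gaussianReal_le_measure_stayIn_Ici (hX : IsMeasurableBrownian X P) (T : ℝ≥0) {b : ℝ}
    (hb : 0 ≤ b) :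
    gaussianReal 0 T (Icc (-b) b) ≤ P {ω | (X · ω) ∈ stayIn T (Ici (-b))} := by
  have hP := hX.isProbabilityMeasure
  have h1 := hX.measure_notMem_stayIn_Ici_le_compl T hb
  rw [hX.measure_eval T measurableSet_Icc.compl] at h1
  have hS : MeasurableSet {ω | (X · ω) ∈ stayIn T (Ici (-b))} :=
    (measurableSet_stayIn T measurableSet_Ici).preimage hX.measurable_process
  have h2 : P {ω | (X · ω) ∈ stayIn T (Ici (-b))}ᶜ ≤ gaussianReal 0 T (Icc (-b) b)ᶜ := h1
  rw [prob_compl_eq_one_sub hS, prob_compl_eq_one_sub measurableSet_Icc] at h2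
  exact (ENNReal.sub_le_sub_iff_left prob_le_one ENNReal.one_ne_top).1 h2

theorem measure_stayIn_Icc_ge (hX : IsMeasurableBrownian X P) :
    2⁻¹ ≤ P {ω | (X · ω) ∈ stayIn 1 (Icc (-3) 3)} := by
  have hP := hX.isProbabilityMeasure
  have hS : MeasurableSet {ω | (X · ω) ∈ stayIn 1 (Icc (-3) 3)} :=
    (measurableSet_stayIn 1 measurableSet_Icc).preimage hX.measurable_process
  have hcheb : P {ω | X 1 ω ∈ (Icc (-3) 3)ᶜ} ≤ 9⁻¹ := by
    have hL := (hX.isBrownian.isGaussianProcess.hasGaussianLaw_eval 1).memLp_two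
    have h := meas_ge_le_variance_div_sq hL (c := 3) (by norm_num)
    rw [hX.isBrownian.integral_eval, (hX.isBrownian.hasLaw_eval 1).variance_eq,
      variance_id_gaussianReal] at h
    refine (measure_mono fun ω hω => ?_).trans (h.trans_eq ?_)
    · simp only [mem_ofPred_eq, mem_compl_iff, mem_Icc, ← abs_le, not_le] at hω
      simpa using hω.le
    · rw [show ((1 : ℝ≥0) : ℝ) / 3 ^ 2 = (9 : ℝ)⁻¹ by norm_num,
        ENNReal.ofReal_inv_of_pos (by norm_num)]
      norm_num
  have h1 := (hX.measure_notMem_stayIn_Ici_le_compl 1 (b := 3) (by norm_num)).trans hcheb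
  have h2 := (hX.neg.measure_notMem_stayIn_Ici_le_compl 1 (b := 3) (by norm_num))
  have h3 : P {ω | (-X) 1 ω ∈ (Icc (-3) 3)ᶜ} = P {ω | X 1 ω ∈ (Icc (-3) 3)ᶜ} := by
    rw [hX.neg.measure_eval 1 measurableSet_Icc.compl, hX.measure_eval 1 measurableSet_Icc.compl]
  rw [h3] at h2
  have h4 : P {ω | (X · ω) ∈ stayIn 1 (Icc (-3) 3)}ᶜ ≤ 2⁻¹ := by
    calc P {ω | (X · ω) ∈ stayIn 1 (Icc (-3) 3)}ᶜ
        ≤ P ({ω | (X · ω) ∉ stayIn 1 (Ici (-3))} ∪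
            {ω | ((-X) · ω) ∉ stayIn 1 (Ici (-3))}) := by
          refine measure_mono fun ω hω => ?_
          by_contra hcon
          simp only [mem_union, mem_ofPred_eq, not_or, not_not] at hcon
          refine hω fun n => ⟨hcon.1 n, ?_⟩
          have : -3 ≤ -X (min (TopologicalSpace.denseSeq ℝ≥0 n) 1) ω := hcon.2 n
          linarith
      _ ≤ _ := measure_union_le _ _
      _ ≤ 9⁻¹ + 9⁻¹ := add_le_add h1 (h2.trans hcheb)
      _ ≤ 4⁻¹ + 4⁻¹ := by gcongr <;> norm_num
      _ = 2⁻¹ := by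
          rw [← two_mul, show (4 : ℝ≥0∞) = 2 * 2 by norm_num,
            ENNReal.mul_inv (by simp) (by simp), ← mul_assoc,
            ENNReal.mul_inv_cancel (by norm_num) (by norm_num), one_mul]
  rw [prob_compl_eq_one_sub hS, tsub_le_iff_right] at h4
  have h5 : (2⁻¹ : ℝ≥0∞) + 2⁻¹ ≤ 2⁻¹ + P {ω | (X · ω) ∈ stayIn 1 (Icc (-3) 3)} := by
    rwa [ENNReal.inv_two_add_inv_two]
  exact (ENNReal.add_le_add_iff_left (by simp)).1 h5

end IsMeasurableBrownian

/-- The paths whose displacement on `[0, 1/4]` is at most `1` away from `d`. -/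
def jumpSet (d : ℝ) : Set (ℝ≥0 → ℝ) := {x | x (1 / 4) - x 0 ∈ Icc (d - 1) (d + 1)}

theorem measurableSet_jumpSet (d : ℝ) : MeasurableSet (jumpSet d) :=
  measurableSet_Icc.preimage (f := fun x : ℝ≥0 → ℝ => x (1 / 4) - x 0)
    (by fun_prop)

/-- The paths which move by about `d` on `[0, 1/4]`, then stay for one unit of time at distance at
most `3`, and whose increments are in `G` afterwards. -/
def jumpStaySet (d : ℝ) (G : Set (ℝ≥0 → ℝ)) : Set (ℝ≥0 → ℝ) :=
  concatSet (1 / 4) (jumpSet d) (concatSet 1 (stayIn 1 (Icc (-3) 3)) G)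

theorem measurableSet_jumpStaySet (d : ℝ) {G : Set (ℝ≥0 → ℝ)} (hG : MeasurableSet G) :
    MeasurableSet (jumpStaySet d G) :=
  measurableSet_concatSet _ (measurableSet_jumpSet d)
    (measurableSet_concatSet _ (measurableSet_stayIn 1 measurableSet_Icc) hG)

/-- The paths which move by about `d` on `[0, 1/4]`, and then stay above the point reached,
minus `5`, for a time `T`. -/
def jumpAboveSet (d : ℝ) (T : ℝ≥0) : Set (ℝ≥0 → ℝ) :=
  concatSet (1 / 4) (jumpSet d) (stayIn T (Ici (-5)))

theorem measurableSet_jumpAboveSet (d : ℝ) (T : ℝ≥0) : MeasurableSet (jumpAboveSet d T) :=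
  measurableSet_concatSet _ (measurableSet_jumpSet d) (measurableSet_stayIn T measurableSet_Ici)

/-- The paths which successively visit neighbourhoods of `z₁`, `z₂`, `z₃` for one unit of time each,
and then stay in a half-line around `z₄` for a time `T`. -/
def tourSet (z₁ z₂ z₃ z₄ : ℝ) (T : ℝ≥0) : Set (ℝ≥0 → ℝ) :=
  jumpStaySet z₁ (jumpStaySet (z₂ - z₁) (jumpStaySet (z₃ - z₂) (jumpAboveSet (z₄ - z₃) T)))

theorem measurableSet_tourSet (z₁ z₂ z₃ z₄ : ℝ) (T : ℝ≥0) :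
    MeasurableSet (tourSet z₁ z₂ z₃ z₄ T) :=
  measurableSet_jumpStaySet _ (measurableSet_jumpStaySet _ (measurableSet_jumpStaySet _
    (measurableSet_jumpAboveSet _ _)))

theorem continuous_shiftPath {x : ℝ≥0 → ℝ} (hx : Continuous x) (s : ℝ≥0) :
    Continuous (shiftPath s x) := by
  unfold shiftPath
  fun_prop

theorem shiftPath_zero (s : ℝ≥0) (x : ℝ≥0 → ℝ) : shiftPath s x 0 = 0 := by simp [shiftPath]

theorem abs_sub_le_of_stopPath_mem_jumpSet {x : ℝ≥0 → ℝ} (h0 : x 0 = 0) {d : ℝ}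
    (h : stopPath (1 / 4) x ∈ jumpSet d) : |x (1 / 4) - d| ≤ 1 := by
  have h' : x (min (1 / 4) (1 / 4)) - x (min 0 (1 / 4)) ∈ Icc (d - 1) (d + 1) := h
  rw [min_self, min_eq_left zero_le, h0, sub_zero] at h'
  exact abs_le.2 ⟨by linarith [h'.1], by linarith [h'.2]⟩

theorem abs_sub_le_of_mem_jumpStaySet {x : ℝ≥0 → ℝ} (hx : Continuous x) (h0 : x 0 = 0) {d : ℝ}
    {G : Set (ℝ≥0 → ℝ)} (h : x ∈ jumpStaySet d G) {t : ℝ≥0} (ht : t ∈ Icc (1 / 4 : ℝ≥0) (5 / 4)) :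
    |x t - d| ≤ 4 := by
  have h1 := abs_sub_le_of_stopPath_mem_jumpSet h0 h.1
  obtain ⟨u, rfl⟩ := exists_add_of_le ht.1
  have hu : u ≤ 1 := by
    have := ht.2
    rw [show (5 / 4 : ℝ≥0) = 1 / 4 + 1 by rw [← NNReal.coe_inj]; norm_num] at this
    exact (add_le_add_iff_left _).1 this
  have hc : Continuous (stopPath 1 (shiftPath (1 / 4) x)) :=
    (continuous_shiftPath hx _).comp (continuous_id.min continuous_const)
  have h2 := mem_of_mem_stayIn isClosed_Icc hc h.2.1 hu
  have h3 : x (1 / 4 + min u 1) - x (1 / 4) ∈ Icc (-3 : ℝ) 3 := h2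
  rw [min_eq_left hu] at h3
  rw [abs_le] at h1 ⊢
  constructor <;> linarith [h1.1, h1.2, h3.1, h3.2]

theorem shiftPath_mem_of_mem_jumpStaySet {x : ℝ≥0 → ℝ} {d : ℝ} {G : Set (ℝ≥0 → ℝ)}
    (h : x ∈ jumpStaySet d G) : shiftPath (5 / 4) x ∈ G := by
  have h1 : shiftPath 1 (shiftPath (1 / 4) x) ∈ G := h.2.2
  rw [shiftPath_shiftPath] at h1
  rwa [show (5 / 4 : ℝ≥0) = 1 / 4 + 1 by rw [← NNReal.coe_inj]; norm_num]

theorem le_of_mem_jumpAboveSet {x : ℝ≥0 → ℝ} (hx : Continuous x) (h0 : x 0 = 0) {d : ℝ} {T : ℝ≥0}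
    (h : x ∈ jumpAboveSet d T) {t : ℝ≥0} (ht : t ∈ Icc (1 / 4 : ℝ≥0) (1 / 4 + T)) :
    d - 6 ≤ x t := by
  have h1 := abs_sub_le_of_stopPath_mem_jumpSet h0 h.1
  obtain ⟨u, rfl⟩ := exists_add_of_le ht.1
  have h2 := mem_of_mem_stayIn isClosed_Ici (continuous_shiftPath hx _) h.2
    ((add_le_add_iff_left _).1 ht.2)
  have h3 : -5 ≤ x (1 / 4 + u) - x (1 / 4) := h2
  rw [abs_le] at h1
  linarith [h1.1]

theorem shiftPath_jumpStay_bound {x : ℝ≥0 → ℝ} (hx : Continuous x) {s : ℝ≥0} {d : ℝ}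
    {G : Set (ℝ≥0 → ℝ)} (h : shiftPath s x ∈ jumpStaySet d G) {t : ℝ≥0}
    (ht : t ∈ Icc (s + 1 / 4) (s + 5 / 4)) : |x t - x s - d| ≤ 4 := by
  obtain ⟨u, rfl⟩ := exists_add_of_le (le_self_add.trans ht.1)
  exact abs_sub_le_of_mem_jumpStaySet (continuous_shiftPath hx s) (shiftPath_zero s x) h
    ⟨(add_le_add_iff_left _).1 ht.1, (add_le_add_iff_left _).1 ht.2⟩

theorem tourSet_spec {x : ℝ≥0 → ℝ} (hx : Continuous x) (h0 : x 0 = 0) {z₁ z₂ z₃ z₄ : ℝ} {T : ℝ≥0}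
    (h : x ∈ tourSet z₁ z₂ z₃ z₄ T) :
    (∀ t ∈ Icc (1 / 4 : ℝ≥0) (5 / 4), |x t - z₁| ≤ 12) ∧
    (∀ t ∈ Icc (3 / 2 : ℝ≥0) (5 / 2), |x t - z₂| ≤ 12) ∧
    (∀ t ∈ Icc (11 / 4 : ℝ≥0) (15 / 4), |x t - z₃| ≤ 12) ∧
    (∀ t ∈ Icc (4 : ℝ≥0) (4 + T), z₄ - 18 ≤ x t) := by
  have e1 : (3 / 2 : ℝ≥0) = 5 / 4 + 1 / 4 := by rw [← NNReal.coe_inj]; norm_num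
  have e2 : (5 / 2 : ℝ≥0) = 5 / 4 + 5 / 4 := by rw [← NNReal.coe_inj]; norm_num
  have e3 : (11 / 4 : ℝ≥0) = 5 / 2 + 1 / 4 := by rw [← NNReal.coe_inj]; norm_num
  have e4 : (15 / 4 : ℝ≥0) = 5 / 2 + 5 / 4 := by rw [← NNReal.coe_inj]; norm_num
  have e5 : (4 : ℝ≥0) = 15 / 4 + 1 / 4 := by rw [← NNReal.coe_inj]; norm_num
  have b1 : ∀ t ∈ Icc (1 / 4 : ℝ≥0) (5 / 4), |x t - z₁| ≤ 4 := fun t ht =>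
    abs_sub_le_of_mem_jumpStaySet hx h0 h ht
  have m1 := shiftPath_mem_of_mem_jumpStaySet h
  have b2 : ∀ t ∈ Icc (3 / 2 : ℝ≥0) (5 / 2), |x t - x (5 / 4) - (z₂ - z₁)| ≤ 4 := fun t ht =>
    shiftPath_jumpStay_bound hx m1 (by rwa [← e1, ← e2])
  have m2 := shiftPath_mem_of_mem_jumpStaySet m1
  rw [shiftPath_shiftPath, ← e2] at m2
  have b3 : ∀ t ∈ Icc (11 / 4 : ℝ≥0) (15 / 4), |x t - x (5 / 2) - (z₃ - z₂)| ≤ 4 := fun t ht =>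
    shiftPath_jumpStay_bound hx m2 (by rwa [← e3, ← e4])
  have m3 := shiftPath_mem_of_mem_jumpStaySet m2
  rw [shiftPath_shiftPath, ← e4] at m3
  have b4 : ∀ t ∈ Icc (4 : ℝ≥0) (4 + T), z₄ - z₃ - 6 ≤ x t - x (15 / 4) := by
    intro t ht
    rw [e5] at ht
    obtain ⟨u, rfl⟩ := exists_add_of_le (le_self_add.trans ht.1)
    refine le_of_mem_jumpAboveSet (continuous_shiftPath hx _) (shiftPath_zero _ x) m3 ⟨?_, ?_⟩
    · exact (add_le_add_iff_left _).1 ht.1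
    · exact (add_le_add_iff_left (15 / 4)).1 (by rw [← add_assoc]; exact ht.2)
  have c1 := abs_le.1 (b1 (5 / 4) ⟨by rw [← NNReal.coe_le_coe]; norm_num, le_rfl⟩)
  have c2 := abs_le.1 (b2 (5 / 2) ⟨by rw [← NNReal.coe_le_coe]; norm_num, le_rfl⟩)
  have c3 := abs_le.1 (b3 (15 / 4) ⟨by rw [← NNReal.coe_le_coe]; norm_num, le_rfl⟩)
  refine ⟨fun t ht => (b1 t ht).trans (by norm_num), fun t ht => ?_, fun t ht => ?_, fun t ht => ?_⟩
  · have := abs_le.1 (b2 t ht)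
    exact abs_le.2 ⟨by linarith, by linarith⟩
  · have := abs_le.1 (b3 t ht)
    exact abs_le.2 ⟨by linarith, by linarith⟩
  · have := b4 t ht
    linarith

namespace IsMeasurableBrownian

theorem measure_stopPath_mem_jumpSet {Ω : Type*} [MeasurableSpace Ω] {X : ℝ≥0 → Ω → ℝ}
    {P : Measure Ω} (hX : IsMeasurableBrownian X P) (d : ℝ) :
    P {ω | stopPath (1 / 4) (X · ω) ∈ jumpSet d} =
      gaussianReal 0 (1 / 4) (Icc (d - 1) (d + 1)) := by
  rw [← hX.measure_eval (1 / 4) measurableSet_Icc]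
  refine measure_congr (Filter.eventuallyEq_set.2 ?_)
  filter_upwards [hX.isBrownian.eval_zero_ae_eq_zero] with ω h
  change X (min (1 / 4) (1 / 4)) ω - X (min 0 (1 / 4)) ω ∈ Icc (d - 1) (d + 1) ↔ _
  rw [min_self, min_eq_left zero_le, h, sub_zero]

theorem measure_jumpStaySet_ge {Ω : Type*} [MeasurableSpace Ω] {X : ℝ≥0 → Ω → ℝ}
    {P : Measure Ω} (hX : IsMeasurableBrownian X P) (d : ℝ) {G : Set (ℝ≥0 → ℝ)}
    (hG : MeasurableSet G) :
    gaussianReal 0 (1 / 4) (Icc (d - 1) (d + 1)) * (2⁻¹ * P {ω | (X · ω) ∈ G}) ≤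
      P {ω | (X · ω) ∈ jumpStaySet d G} := by
  have hS := measurableSet_stayIn 1 (measurableSet_Icc (a := (-3 : ℝ)) (b := 3))
  rw [jumpStaySet, hX.measure_concatSet _ (measurableSet_jumpSet d)
    (measurableSet_concatSet _ hS hG), hX.measure_concatSet _ hS hG,
    hX.measure_stopPath_mem_jumpSet]
  gcongr
  refine hX.measure_stayIn_Icc_ge.trans_eq ?_
  congr 1
  ext ω
  change (∀ n, _) ↔ ∀ n, X (min (min _ 1) 1) ω ∈ _
  simp only [min_assoc, min_self]

/-- The probability that a Brownian motion follows a given tour, and then stays in a half-line for a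
time `T`, is of order at least `1 / √T`. -/
theorem exists_measure_tourSet_ge (z₁ z₂ z₃ z₄ : ℝ) :
    ∃ c : ℝ, 0 < c ∧ ∀ (Ω : Type*) [MeasurableSpace Ω] (X : ℝ≥0 → Ω → ℝ) (P : Measure Ω),
      IsMeasurableBrownian X P → ∀ T : ℝ≥0, 1 ≤ T →
        ENNReal.ofReal (c / √T) ≤ P {ω | (X · ω) ∈ tourSet z₁ z₂ z₃ z₄ T} := by
  let g : ℝ → ℝ := fun d => (gaussianReal 0 (1 / 4)).real (Icc (d - 1) (d + 1))
  have hg : ∀ d, 0 < g d := fun d =>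
    ENNReal.toReal_pos (gaussianReal_Icc_pos d (by norm_num)).ne' (measure_ne_top _ _)
  have hg' : ∀ d, gaussianReal 0 (1 / 4) (Icc (d - 1) (d + 1)) = ENNReal.ofReal (g d) := fun d =>
    (ENNReal.ofReal_toReal (measure_ne_top _ _)).symm
  have h2 : (2⁻¹ : ℝ≥0∞) = ENNReal.ofReal 2⁻¹ := by
    rw [ENNReal.ofReal_inv_of_pos (by norm_num)]; norm_num
  set a := 2 * ((√(2 * Real.pi))⁻¹ * Real.exp (-1)) with ha
  have ha0 : 0 < a := by positivity
  refine ⟨g z₁ * (2⁻¹ * (g (z₂ - z₁) * (2⁻¹ * (g (z₃ - z₂) * (2⁻¹ * (g (z₄ - z₃) * a)))))),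
    ?_, fun Ω _ X P hX T hT => ?_⟩
  · have := hg z₁
    have := hg (z₂ - z₁)
    have := hg (z₃ - z₂)
    have := hg (z₄ - z₃)
    positivity
  have hlast : ENNReal.ofReal (g (z₄ - z₃)) * ENNReal.ofReal (a / √T) ≤
      P {ω | (X · ω) ∈ jumpAboveSet (z₄ - z₃) T} := by
    rw [jumpAboveSet, hX.measure_concatSet _ (measurableSet_jumpSet _)
      (measurableSet_stayIn T measurableSet_Ici), hX.measure_stopPath_mem_jumpSet, hg']
    gcongr
    refine (le_gaussianReal_Icc hT).trans (le_trans (measure_mono ?_)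
      (hX.gaussianReal_le_measure_stayIn_Ici T (b := 5) (by norm_num)))
    exact Icc_subset_Icc (by norm_num) (by norm_num)
  have m1 := measurableSet_jumpAboveSet (z₄ - z₃) T
  have m2 := measurableSet_jumpStaySet (z₃ - z₂) m1
  have m3 := measurableSet_jumpStaySet (z₂ - z₁) m2
  have k1 := hX.measure_jumpStaySet_ge (z₃ - z₂) m1
  have k2 := hX.measure_jumpStaySet_ge (z₂ - z₁) m2
  have k3 := hX.measure_jumpStaySet_ge z₁ m3
  rw [hg', h2] at k1 k2 k3
  refine le_trans (le_of_eq ?_) ((mul_le_mul_right (mul_le_mul_right ((mul_le_mul_right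
    (mul_le_mul_right ((mul_le_mul_right (mul_le_mul_right hlast _) _).trans k1) _) _).trans k2)
    _) _).trans k3)
  have h3 : (0 : ℝ) ≤ 2⁻¹ := by norm_num
  rw [← ENNReal.ofReal_mul (hg _).le, ← ENNReal.ofReal_mul h3, ← ENNReal.ofReal_mul (hg _).le,
    ← ENNReal.ofReal_mul h3, ← ENNReal.ofReal_mul (hg _).le, ← ENNReal.ofReal_mul h3,
    ← ENNReal.ofReal_mul (hg _).le]
  congr 1
  ring

end IsMeasurableBrownian

theorem mem_quadrant_zero {x : EuclideanSpace ℝ (Fin 2)} : x ∈ quadrant 0 ↔ 0 < x 0 ∧ 0 < x 1 :=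
  Iff.rfl

theorem mem_quadrant_one {x : EuclideanSpace ℝ (Fin 2)} : x ∈ quadrant 1 ↔ 0 < x 0 ∧ x 1 < 0 :=
  Iff.rfl

theorem mem_quadrant_two {x : EuclideanSpace ℝ (Fin 2)} : x ∈ quadrant 2 ↔ x 0 < 0 ∧ x 1 < 0 :=
  Iff.rfl

theorem mem_quadrant_three {x : EuclideanSpace ℝ (Fin 2)} : x ∈ quadrant 3 ↔ x 0 < 0 ∧ 0 < x 1 :=
  Iff.rfl

theorem disjoint_quadrant {i j : Fin 4} (h : i ≠ j) : Disjoint (quadrant i) (quadrant j) := by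
  refine Set.disjoint_left.2 fun x hi hj => ?_
  fin_cases i <;> fin_cases j <;>
    simp only [Fin.zero_eta, Fin.mk_one, Fin.reduceFinMk, mem_quadrant_zero, mem_quadrant_one,
      mem_quadrant_two, mem_quadrant_three, ne_eq, not_true_eq_false] at hi hj h <;>
    linarith [hi.1, hi.2, hj.1, hj.2]

/-- The set of times in `(0, 1]` at which the planar path `w` is in the quadrant `i`. -/
def quadrantTimes (w : ℝ≥0 → EuclideanSpace ℝ (Fin 2)) (i : Fin 4) : Set ℝ :=
  Ioc 0 1 ∩ {t | w t.toNNReal ∈ quadrant i}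

theorem measurableSet_quadrantTimes {w : ℝ≥0 → EuclideanSpace ℝ (Fin 2)} (hw : Measurable w)
    (i : Fin 4) : MeasurableSet (quadrantTimes w i) :=
  measurableSet_Ioc.inter ((measurableSet_quadrant i).preimage
    (hw.comp measurable_real_toNNReal))

theorem volume_quadrantTimes_ne_top (w : ℝ≥0 → EuclideanSpace ℝ (Fin 2)) (i : Fin 4) :
    volume (quadrantTimes w i) ≠ ∞ :=
  ((measure_mono inter_subset_left).trans_lt (by simp)).ne

theorem occTime_eq_volume {Ω : Type*} {W : ℝ≥0 → Ω → EuclideanSpace ℝ (Fin 2)} {ω : Ω}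
    (hw : Measurable (W · ω)) (i : Fin 4) :
    occTime W i ω = volume.real (quadrantTimes (W · ω) i) := by
  have hm : MeasurableSet {t : ℝ | W t.toNNReal ω ∈ quadrant i} :=
    (measurableSet_quadrant i).preimage (hw.comp measurable_real_toNNReal)
  have : (fun t : ℝ => (quadrant i).indicator (fun _ => (1 : ℝ)) (W t.toNNReal ω)) =
      {t : ℝ | W t.toNNReal ω ∈ quadrant i}.indicator 1 := by
    ext t; simp [indicator]
  rw [occTime, intervalIntegral.integral_of_le zero_le_one, this, integral_indicator_one hm,
    measureReal_restrict_apply hm, inter_comm]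
  rfl

/-- A path which is in the quadrants `1`, `2`, `3` during consecutive intervals of length `ε`
contained in `[0, 4 ε]`, and in the quadrant `0` after time `4 ε`, spends a time between `ε` and
`2 ε` in each of the quadrants `1`, `2`, `3`. -/
theorem volume_quadrantTimes_mem_Icc {w : ℝ≥0 → EuclideanSpace ℝ (Fin 2)} (hw : Measurable w)
    {ε : ℝ} (hε : 0 < ε) (hε1 : 4 * ε ≤ 1)
    (h1 : ∀ t ∈ Icc (ε * (1 / 4)) (ε * (5 / 4)), w t.toNNReal ∈ quadrant 1)
    (h2 : ∀ t ∈ Icc (ε * (3 / 2)) (ε * (5 / 2)), w t.toNNReal ∈ quadrant 2)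
    (h3 : ∀ t ∈ Icc (ε * (11 / 4)) (ε * (15 / 4)), w t.toNNReal ∈ quadrant 3)
    (h0 : ∀ t ∈ Icc (ε * 4) 1, w t.toNNReal ∈ quadrant 0) (i : Fin 4) (hi : i ≠ 0) :
    volume.real (quadrantTimes w i) ∈ Icc ε (2 * ε) := by
  have low : ∀ (j : Fin 4) (a b : ℝ), 0 < a → b ≤ 4 → b - a = 1 →
      (∀ t ∈ Icc (ε * a) (ε * b), w t.toNNReal ∈ quadrant j) →
      ε ≤ volume.real (quadrantTimes w j) := by
    intro j a b ha hb hab h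
    calc ε = volume.real (Icc (ε * a) (ε * b)) := by
          rw [Real.volume_real_Icc_of_le (by nlinarith), ← mul_sub, hab, mul_one]
      _ ≤ _ := by
          refine measureReal_mono (fun t ht => ?_) (volume_quadrantTimes_ne_top w j)
          exact ⟨⟨lt_of_lt_of_le (by positivity) ht.1, ht.2.trans (by nlinarith)⟩, h t ht⟩
  have l1 := low 1 _ _ (by norm_num) (by norm_num) (by norm_num) h1
  have l2 := low 2 _ _ (by norm_num) (by norm_num) (by norm_num) h2
  have l3 := low 3 _ _ (by norm_num) (by norm_num) (by norm_num) h3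
  have hsub : ∀ j : Fin 4, j ≠ 0 → quadrantTimes w j ⊆ Ioc 0 (4 * ε) := fun j hj t ht =>
    ⟨ht.1.1, by
      by_contra! hlt
      exact Set.disjoint_left.1 (disjoint_quadrant hj) ht.2
        (h0 t ⟨by linarith, ht.1.2⟩)⟩
  have hd : ∀ j k : Fin 4, j ≠ k → Disjoint (quadrantTimes w j) (quadrantTimes w k) :=
    fun j k hjk => Set.disjoint_left.2 fun t hj hk =>
      Set.disjoint_left.1 (disjoint_quadrant hjk) hj.2 hk.2
  have hm := fun j => measurableSet_quadrantTimes hw j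
  have hf := fun j => volume_quadrantTimes_ne_top w j
  have hsum : volume.real (quadrantTimes w 1) + volume.real (quadrantTimes w 2) +
      volume.real (quadrantTimes w 3) ≤ 4 * ε := by
    rw [← measureReal_union (hd 1 2 (by decide)) (hm 2) (hf 1) (hf 2),
      ← measureReal_union ((hd 1 3 (by decide)).union_left (hd 2 3 (by decide))) (hm 3)
        (measure_union_ne_top (hf 1) (hf 2)) (hf 3)]
    calc _ ≤ volume.real (Ioc 0 (4 * ε)) := measureReal_mono (union_subset (union_subset
          (hsub 1 (by decide)) (hsub 2 (by decide))) (hsub 3 (by decide))) measure_Ioc_lt_top.ne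
      _ = 4 * ε := by rw [Real.volume_real_Ioc_of_le (by positivity), sub_zero]
  fin_cases i
  · exact absurd rfl hi
  · exact ⟨l1, by change volume.real (quadrantTimes w 1) ≤ _; linarith⟩
  · exact ⟨l2, by change volume.real (quadrantTimes w 2) ≤ _; linarith⟩
  · exact ⟨l3, by change volume.real (quadrantTimes w 3) ≤ _; linarith⟩

/-- The zero set of a Brownian motion is almost surely negligible. -/
theorem IsMeasurableBrownian.ae_volume_zeros_eq_zero {Ω : Type*} [MeasurableSpace Ω]
    {X : ℝ≥0 → Ω → ℝ} {P : Measure Ω} (hX : IsMeasurableBrownian X P) :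
    ∀ᵐ ω ∂P, volume (Ioc (0 : ℝ) 1 ∩ {t | X t.toNNReal ω = 0}) = 0 := by
  have hP := hX.isProbabilityMeasure
  let D : Set (Ω × ℝ) := {p | p.2 ∈ Ioc (0 : ℝ) 1 ∧ X p.2.toNNReal p.1 = 0}
  have hD : MeasurableSet D := (measurableSet_Ioc.preimage measurable_snd).inter
    ((measurableSet_singleton (0 : ℝ)).preimage
      (hX.measurable_comp (measurable_real_toNNReal.comp measurable_snd) measurable_fst))
  have h0 : (P.prod volume) D = 0 := by
    rw [Measure.prod_apply_symm hD, lintegral_eq_zero_iff (measurable_measure_prodMk_right hD)]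
    refine ae_of_all _ fun t => ?_
    by_cases ht : t ∈ Ioc (0 : ℝ) 1
    · have htn : t.toNNReal ≠ 0 := by simpa using ht.1
      have := nullSingletonClass_gaussianReal (μ := 0) htn
      refine measure_mono_null (t := {ω | X t.toNNReal ω ∈ ({0} : Set ℝ)}) (fun ω hω => hω.2) ?_
      rw [hX.measure_eval _ (measurableSet_singleton _)]
      exact measure_singleton 0
    · have hempty : (fun ω => (ω, t)) ⁻¹' D = ∅ := by
        ext ω; simp only [mem_empty_iff_false, iff_false]; exact fun h => ht h.1
      change P ((fun ω => (ω, t)) ⁻¹' D) = 0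
      rw [hempty, measure_empty]
  rw [Measure.prod_apply hD, lintegral_eq_zero_iff (measurable_measure_prodMk_left hD)] at h0
  exact h0

namespace IsPlanarBrownian

variable {Ω : Type*} [MeasurableSpace Ω] {W : ℝ≥0 → Ω → EuclideanSpace ℝ (Fin 2)} {P : Measure Ω}

theorem isMeasurableBrownian (hW : IsPlanarBrownian W P) (j : Fin 2) :
    IsMeasurableBrownian (fun t ω => W t ω j) P :=
  ⟨(show Measurable fun x : EuclideanSpace ℝ (Fin 2) => x j by fun_prop).comp hW.measurable,
    hW.coord j⟩

theorem measurable_path (hW : IsPlanarBrownian W P) (ω : Ω) : Measurable (W · ω) :=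
  hW.measurable.comp measurable_prodMk_right

theorem timeNonpos_le_of_mem_smallTimes (hW : IsPlanarBrownian W P) {ε : ℝ} {ω : Ω}
    (hω : ω ∈ smallTimes W ε)
    (hz : ∀ j, volume (Ioc (0 : ℝ) 1 ∩ {t | W t.toNNReal ω j = 0}) = 0) (j : Fin 2) :
    timeNonpos 1 (fun t => W t ω j) ≤ ENNReal.ofReal (4 * ε) := by
  have hvol : ∀ i : Fin 4, i ≠ 0 →
      volume (quadrantTimes (W · ω) i) ≤ ENNReal.ofReal (2 * ε) := fun i hi => by
    rw [← ENNReal.ofReal_toReal (volume_quadrantTimes_ne_top (W · ω) i)]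
    refine ENNReal.ofReal_le_ofReal ?_
    have := (hω i hi).2
    rwa [occTime_eq_volume (hW.measurable_path ω)] at this
  have hε : 0 ≤ ε := by
    have := hω 1 (by decide)
    linarith [this.1.trans this.2]
  have key : ∀ i i' : Fin 4, i ≠ 0 → i' ≠ 0 →
      (∀ x : EuclideanSpace ℝ (Fin 2), x j ≤ 0 →
        x ∈ quadrant i ∨ x ∈ quadrant i' ∨ x 0 = 0 ∨ x 1 = 0) →
      timeNonpos 1 (fun t => W t ω j) ≤ ENNReal.ofReal (4 * ε) := by
    intro i i' hi hi' h
    rw [timeNonpos_eq_volume ((hW.isMeasurableBrownian j).measurable_path ω)]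
    calc _ ≤ volume ((quadrantTimes (W · ω) i ∪ quadrantTimes (W · ω) i') ∪
            ((Ioc (0 : ℝ) 1 ∩ {t | W t.toNNReal ω 0 = 0}) ∪
              (Ioc (0 : ℝ) 1 ∩ {t | W t.toNNReal ω 1 = 0}))) := by
          refine measure_mono fun t ht => ?_
          rcases h _ ht.2 with h | h | h | h
          · exact Or.inl (Or.inl ⟨ht.1, h⟩)
          · exact Or.inl (Or.inr ⟨ht.1, h⟩)
          · exact Or.inr (Or.inl ⟨ht.1, h⟩)
          · exact Or.inr (Or.inr ⟨ht.1, h⟩)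
      _ ≤ _ := measure_union_le _ _
      _ ≤ (ENNReal.ofReal (2 * ε) + ENNReal.ofReal (2 * ε)) + 0 :=
          add_le_add ((measure_union_le _ _).trans (add_le_add (hvol i hi) (hvol i' hi')))
            ((measure_union_le _ _).trans (by rw [hz, hz, add_zero]))
      _ = ENNReal.ofReal (4 * ε) := by
          rw [add_zero, ← ENNReal.ofReal_add (by positivity) (by positivity)]
          congr 1; ring
  fin_cases j
  · refine key 2 3 (by decide) (by decide) fun x hx => ?_
    have hx : x 0 ≤ 0 := hx
    simp only [mem_quadrant_two, mem_quadrant_three]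
    rcases lt_trichotomy (x 0) 0 with h | h | h <;> rcases lt_trichotomy (x 1) 0 with h' | h' | h'
      <;> grind
  · refine key 1 2 (by decide) (by decide) fun x hx => ?_
    have hx : x 1 ≤ 0 := hx
    simp only [mem_quadrant_two, mem_quadrant_one]
    rcases lt_trichotomy (x 0) 0 with h | h | h <;> rcases lt_trichotomy (x 1) 0 with h' | h' | h'
      <;> grind

theorem measure_smallTimes_inter_le (hW : IsPlanarBrownian W P) {ε : ℝ} :
    P (smallTimes W ε ∩ {ω | W 1 ω ∈ quadrant 2}) ≤ 128 * ENNReal.ofReal (4 * ε) ^ 3 := by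
  let δ := ENNReal.ofReal (4 * ε)
  let G : Set (ℝ≥0 → ℝ) := {x | gridTimeNonpos 1 x ≤ δ ∧ x 1 ≤ 0}
  have hG : MeasurableSet G := (measurableSet_le (measurable_gridTimeNonpos 1)
    measurable_const).inter (measurableSet_le (measurable_pi_apply 1) measurable_const)
  have hbound : ∀ j, P {ω | (fun t => W t ω j) ∈ G} ^ 2 ≤ 128 * δ ^ 3 := fun j => by
    refine le_trans (le_of_eq ?_) ((hW.isMeasurableBrownian j).sq_measure_timeNonpos_and_nonpos_le δ)
    congr 1
    refine measure_congr (Filter.eventuallyEq_set.2 ?_)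
    filter_upwards [(hW.isMeasurableBrownian j).timeNonpos_ae_eq 1] with ω h
    change gridTimeNonpos 1 (fun t => W t ω j) ≤ δ ∧ W 1 ω j ≤ 0 ↔
      timeNonpos 1 (fun t => W t ω j) ≤ δ ∧ W 1 ω j ≤ 0
    rw [h]
  have hle : P (smallTimes W ε ∩ {ω | W 1 ω ∈ quadrant 2}) ≤
      P ({ω | (fun t => W t ω 0) ∈ G} ∩ {ω | (fun t => W t ω 1) ∈ G}) := by
    refine measure_mono_ae ?_
    filter_upwards [(hW.isMeasurableBrownian 0).timeNonpos_ae_eq 1,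
      (hW.isMeasurableBrownian 1).timeNonpos_ae_eq 1,
      (hW.isMeasurableBrownian 0).ae_volume_zeros_eq_zero,
      (hW.isMeasurableBrownian 1).ae_volume_zeros_eq_zero] with ω h0 h1 z0 z1 hω
    obtain ⟨hs, hq⟩ := hω
    have ht := hW.timeNonpos_le_of_mem_smallTimes hs (Fin.forall_fin_two.2 ⟨z0, z1⟩)
    have hq' := mem_quadrant_two.1 hq
    exact ⟨⟨h0 ▸ ht 0, hq'.1.le⟩, ⟨h1 ▸ ht 1, hq'.2.le⟩⟩
  refine hle.trans ?_
  have hind := hW.indep.measure_inter_preimage_eq_mul G G hG hG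
  refine (le_of_eq hind).trans ?_
  set a := P ((fun ω (t : ℝ≥0) => W t ω 0) ⁻¹' G)
  set b := P ((fun ω (t : ℝ≥0) => W t ω 1) ⁻¹' G)
  have ha : a ^ 2 ≤ 128 * δ ^ 3 := hbound 0
  have hb : b ^ 2 ≤ 128 * δ ^ 3 := hbound 1
  rcases le_total a b with h | h
  · exact (mul_le_mul_left h b).trans (by rwa [← sq])
  · exact (mul_le_mul_right h a).trans (by rwa [← sq])

/-- If the coordinates, after Brownian scaling, follow suitable tours, then the planar path spends
a time between `ε` and `2 ε` in each of the quadrants other than the positive one. -/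
theorem mem_smallTimes_of_mem_tourSet (hW : IsPlanarBrownian W P) {ε : ℝ≥0} (hε : 0 < ε)
    (hε1 : 4 * ε ≤ 1) {ω : Ω} (hc : ∀ j, Continuous fun t => W t ω j)
    (h0 : ∀ j, W 0 ω j = 0)
    (hx : (fun t => (√(ε : ℝ))⁻¹ * W (ε * t) ω 0) ∈ tourSet 20 (-20) (-20) 20 (1 / ε))
    (hy : (fun t => (√(ε : ℝ))⁻¹ * W (ε * t) ω 1) ∈ tourSet (-20) (-20) 20 20 (1 / ε)) :
    ω ∈ smallTimes W ε := by
  have hεr : (0 : ℝ) < ε := hε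
  have hsq : 0 < (√(ε : ℝ))⁻¹ := by positivity
  have hcs : ∀ j, Continuous fun t : ℝ≥0 => (√(ε : ℝ))⁻¹ * W (ε * t) ω j := fun j =>
    ((hc j).comp (continuous_const.mul continuous_id)).const_mul _
  obtain ⟨x1, x2, x3, x4⟩ := tourSet_spec (hcs 0) (by simp [h0]) hx
  obtain ⟨y1, y2, y3, y4⟩ := tourSet_spec (hcs 1) (by simp [h0]) hy
  have htime : ∀ {a b : ℝ≥0} {t : ℝ}, t ∈ Icc (ε * a : ℝ) (ε * b) →
      ∃ u ∈ Icc a b, t.toNNReal = ε * u := fun {a b t} ht => by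
    have ht0 : 0 ≤ t := le_trans (by positivity) ht.1
    refine ⟨t.toNNReal / ε, ⟨?_, ?_⟩, ?_⟩
    · rw [le_div_iff₀ hε, ← NNReal.coe_le_coe, NNReal.coe_mul, Real.coe_toNNReal t ht0, mul_comm]
      exact ht.1
    · rw [div_le_iff₀ hε, ← NNReal.coe_le_coe, NNReal.coe_mul, Real.coe_toNNReal t ht0, mul_comm]
      exact ht.2
    · rw [mul_div_cancel₀ _ hε.ne']
  have hpos : ∀ {u : ℝ≥0} {j : Fin 2}, |(√(ε : ℝ))⁻¹ * W (ε * u) ω j - 20| ≤ 12 →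
      0 < W (ε * u) ω j := fun {u j} h =>
    pos_of_mul_pos_right (by linarith [(abs_le.1 h).1]) hsq.le
  have hneg : ∀ {u : ℝ≥0} {j : Fin 2}, |(√(ε : ℝ))⁻¹ * W (ε * u) ω j - -20| ≤ 12 →
      W (ε * u) ω j < 0 := fun {u j} h =>
    neg_of_mul_neg_right (by linarith [(abs_le.1 h).2]) hsq.le
  have hpos' : ∀ {u : ℝ≥0} {j : Fin 2}, 20 - 18 ≤ (√(ε : ℝ))⁻¹ * W (ε * u) ω j →
      0 < W (ε * u) ω j := fun {u j} h => pos_of_mul_pos_right (by linarith) hsq.le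
  intro i hi
  rw [occTime_eq_volume (hW.measurable_path ω)]
  refine volume_quadrantTimes_mem_Icc (hW.measurable_path ω) hεr (by exact_mod_cast hε1)
    (fun t ht => ?_) (fun t ht => ?_) (fun t ht => ?_) (fun t ht => ?_) i hi
  · obtain ⟨u, hu, e⟩ := htime (a := 1 / 4) (b := 5 / 4) (by push_cast; exact ht)
    rw [e]
    exact mem_quadrant_one.2 ⟨hpos (x1 u hu), hneg (y1 u hu)⟩
  · obtain ⟨u, hu, e⟩ := htime (a := 3 / 2) (b := 5 / 2) (by push_cast; exact ht)
    rw [e]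
    exact mem_quadrant_two.2 ⟨hneg (x2 u hu), hneg (y2 u hu)⟩
  · obtain ⟨u, hu, e⟩ := htime (a := 11 / 4) (b := 15 / 4) (by push_cast; exact ht)
    rw [e]
    exact mem_quadrant_three.2 ⟨hneg (x3 u hu), hpos (y3 u hu)⟩
  · obtain ⟨u, hu, e⟩ := htime (a := 4) (b := 1 / ε) (t := t) (by
      push_cast; rw [mul_one_div_cancel hεr.ne']; exact ht)
    rw [e]
    have hu' : u ∈ Icc (4 : ℝ≥0) (4 + 1 / ε) := ⟨hu.1, hu.2.trans le_add_self⟩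
    exact mem_quadrant_zero.2 ⟨hpos' (x4 u hu'), hpos' (y4 u hu')⟩

end IsPlanarBrownian

theorem exists_measure_smallTimes_ge :
    ∃ c : ℝ, 0 < c ∧ ∀ (Ω : Type*) [MeasurableSpace Ω] (P : Measure Ω)
      (W : ℝ≥0 → Ω → EuclideanSpace ℝ (Fin 2)), IsPlanarBrownian W P →
      ∀ ε : ℝ, 0 < ε → 4 * ε ≤ 1 → ENNReal.ofReal (c * ε) ≤ P (smallTimes W ε) := by
  obtain ⟨c₁, hc₁, h₁⟩ := IsMeasurableBrownian.exists_measure_tourSet_ge 20 (-20) (-20) 20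
  obtain ⟨c₂, hc₂, h₂⟩ := IsMeasurableBrownian.exists_measure_tourSet_ge (-20) (-20) 20 20
  refine ⟨c₁ * c₂, mul_pos hc₁ hc₂, fun Ω _ P W hW ε hε hε1 => ?_⟩
  lift ε to ℝ≥0 using hε.le
  have hε' : 0 < ε := hε
  have hX := (hW.isMeasurableBrownian 0).smul hε'.ne'
  have hY := (hW.isMeasurableBrownian 1).smul hε'.ne'
  have hT : 1 ≤ 1 / ε := by
    rw [one_le_div hε', ← NNReal.coe_le_coe]; push_cast; linarith
  have hS₁ := measurableSet_tourSet 20 (-20) (-20) 20 (1 / ε)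
  have hS₂ := measurableSet_tourSet (-20) (-20) 20 20 (1 / ε)
  let φ : (ℝ≥0 → ℝ) → (ℝ≥0 → ℝ) := fun x t => (√(ε : ℝ))⁻¹ * x (ε * t)
  have hφ : Measurable φ := measurable_pi_lambda _ fun t => (measurable_pi_apply _).const_mul _
  have hind := (hW.indep.comp hφ hφ).measure_inter_preimage_eq_mul _ _ hS₁ hS₂
  calc ENNReal.ofReal (c₁ * c₂ * ε)
      = ENNReal.ofReal (c₁ / √((1 / ε : ℝ≥0) : ℝ)) * ENNReal.ofReal (c₂ / √((1 / ε : ℝ≥0) : ℝ)) := by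
        rw [← ENNReal.ofReal_mul (by positivity), div_mul_div_comm,
          Real.mul_self_sqrt (by positivity)]
        congr 1
        push_cast
        field_simp
    _ ≤ _ := mul_le_mul' (h₁ Ω _ P hX _ hT) (h₂ Ω _ P hY _ hT)
    _ = _ := hind.symm
    _ ≤ P (smallTimes W ε) := by
        refine measure_mono_ae ?_
        filter_upwards [(hW.coord 0).cont, (hW.coord 1).cont, (hW.coord 0).eval_zero_ae_eq_zero,
          (hW.coord 1).eval_zero_ae_eq_zero] with ω k0 k1 z0 z1 hω
        refine hW.mem_smallTimes_of_mem_tourSet hε' ?_ (Fin.forall_fin_two.2 ⟨k0, k1⟩)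
          (Fin.forall_fin_two.2 ⟨z0, z1⟩) hω.1 hω.2
        exact_mod_cast hε1

/-- The reflection of the plane which multiplies the coordinate `j` by `σ j`. -/
noncomputable def reflect (σ : Fin 2 → ℝ) (x : EuclideanSpace ℝ (Fin 2)) :
    EuclideanSpace ℝ (Fin 2) :=
  WithLp.toLp 2 fun j => σ j * x j

theorem IsPlanarBrownian.reflect {Ω : Type*} [MeasurableSpace Ω]
    {W : ℝ≥0 → Ω → EuclideanSpace ℝ (Fin 2)} {P : Measure Ω} (hW : IsPlanarBrownian W P)
    {σ : Fin 2 → ℝ} (hσ : ∀ j, σ j = 1 ∨ σ j = -1) :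
    IsPlanarBrownian (fun t ω => reflect σ (W t ω)) P where
  measurable := by
    have : Measurable (_root_.reflect σ) := by
      unfold _root_.reflect
      fun_prop
    exact this.comp hW.measurable
  coord j := by
    rcases hσ j with h | h
    · simpa [_root_.reflect, h] using hW.coord j
    · have : (fun t ω => _root_.reflect σ (W t ω) j) = -fun t ω => W t ω j := by
        ext t ω
        simp [_root_.reflect, h]
      rw [this]
      exact (hW.coord j).neg
  indep := by
    have hm : ∀ j, Measurable fun (x : ℝ≥0 → ℝ) t => σ j * x t := fun j =>
      measurable_pi_lambda _ fun t => (measurable_pi_apply t).const_mul _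
    exact hW.indep.comp (hm 0) (hm 1)

theorem exists_reflect_mem_quadrant (k : Fin 4) :
    ∃ σ : Fin 2 → ℝ, (∀ j, σ j = 1 ∨ σ j = -1) ∧
      (∀ i, ∃ j, ∀ x, reflect σ x ∈ quadrant i ↔ x ∈ quadrant j) ∧
      ∀ x, reflect σ x ∈ quadrant 2 ↔ x ∈ quadrant k := by
  have hq : ∀ (τ : Fin 4 → Fin 4) (σ : Fin 2 → ℝ), (∀ j, σ j = 1 ∨ σ j = -1) →
      (∀ i x, reflect σ x ∈ quadrant i ↔ x ∈ quadrant (τ i)) → τ 2 = k →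
      ∃ σ : Fin 2 → ℝ, (∀ j, σ j = 1 ∨ σ j = -1) ∧
      (∀ i, ∃ j, ∀ x, reflect σ x ∈ quadrant i ↔ x ∈ quadrant j) ∧
      ∀ x, reflect σ x ∈ quadrant 2 ↔ x ∈ quadrant k := fun τ σ hσ h hk =>
    ⟨σ, hσ, fun i => ⟨τ i, h i⟩, fun x => hk ▸ h 2 x⟩
  fin_cases k
  · refine hq ![2, 3, 0, 1] ![-1, -1] (by simp [Fin.forall_fin_two]) (fun i x => ?_) rfl
    fin_cases i <;> simp [quadrant, reflect]
  · refine hq ![3, 2, 1, 0] ![-1, 1] (by simp [Fin.forall_fin_two]) (fun i x => ?_) rfl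
    fin_cases i <;> simp [quadrant, reflect]
  · refine hq id ![1, 1] (by simp [Fin.forall_fin_two]) (fun i x => ?_) rfl
    fin_cases i <;> simp [quadrant, reflect]
  · refine hq ![1, 0, 3, 2] ![1, -1] (by simp [Fin.forall_fin_two]) (fun i x => ?_) rfl
    fin_cases i <;> simp [quadrant, reflect]

theorem exists_measure_smallTimes_inter_le :
    ∃ C > (0 : ℝ), ∀ (Ω : Type*) [MeasurableSpace Ω] (P : Measure Ω) [IsProbabilityMeasure P]
      (W : ℝ≥0 → Ω → EuclideanSpace ℝ (Fin 2)), IsPlanarBrownian W P →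
      ∀ ε : ℝ, 0 < ε → 4 * ε ≤ 1 → 0 < P (smallTimes W ε) ∧
        P.real (smallTimes W ε ∩ {ω | W 1 ω ∈ quadrant 2}) ≤
          C * ε ^ 2 * P.real (smallTimes W ε) := by
  obtain ⟨c, hc, h⟩ := exists_measure_smallTimes_ge
  refine ⟨8192 / c, by positivity, fun Ω _ P _ W hW ε hε hε1 => ?_⟩
  have hlow := h Ω P W hW ε hε hε1
  refine ⟨lt_of_lt_of_le (by simpa using by positivity) hlow, ?_⟩
  have hlow' : c * ε ≤ P.real (smallTimes W ε) :=
    (ENNReal.ofReal_le_iff_le_toReal (measure_ne_top _ _)).1 hlow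
  have hup := ENNReal.toReal_mono (by finiteness) (hW.measure_smallTimes_inter_le (ε := ε))
  rw [ENNReal.toReal_mul, ENNReal.toReal_pow, ENNReal.toReal_ofReal (by positivity),
    ENNReal.toReal_ofNat] at hup
  calc _ ≤ 128 * (4 * ε) ^ 3 := hup
    _ = 8192 / c * ε ^ 2 * (c * ε) := by field_simp; ring
    _ ≤ _ := by gcongr

theorem IsPlanarBrownian.measurableSet_smallTimes {Ω : Type*} [MeasurableSpace Ω]
    {W : ℝ≥0 → Ω → EuclideanSpace ℝ (Fin 2)} {P : Measure Ω} (hW : IsPlanarBrownian W P) (ε : ℝ) :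
    MeasurableSet (smallTimes W ε) := by
  have : smallTimes W ε = ⋂ i, ⋂ (_ : i ≠ 0), occTime W i ⁻¹' Icc ε (2 * ε) := by
    ext ω; simp [smallTimes]
  rw [this]
  exact MeasurableSet.iInter fun i => MeasurableSet.iInter fun _ =>
    measurableSet_Icc.preimage (hW.measurable_occTime i)

/-- The conditional probability of being in a quadrant at time `1` is not the time spent there. -/
theorem not_condExp_ae_eq_occTime {C : ℝ} (hC : 0 < C) {Ω : Type*} [MeasurableSpace Ω]
    {P : Measure Ω} [IsProbabilityMeasure P] {W : ℝ≥0 → Ω → EuclideanSpace ℝ (Fin 2)}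
    (hW : IsPlanarBrownian W P)
    (h : ∀ V : ℝ≥0 → Ω → EuclideanSpace ℝ (Fin 2), IsPlanarBrownian V P →
      ∀ ε : ℝ, 0 < ε → 4 * ε ≤ 1 → 0 < P (smallTimes V ε) ∧
        P.real (smallTimes V ε ∩ {ω | V 1 ω ∈ quadrant 2}) ≤
          C * ε ^ 2 * P.real (smallTimes V ε)) (k : Fin 4) :
    ¬ (P⟦{ω | W 1 ω ∈ quadrant k} | occSigma W⟧ =ᵐ[P] occTime W k) := by
  intro heq
  obtain ⟨σ, hσ, hquad, hk⟩ := exists_reflect_mem_quadrant k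
  have hV := hW.reflect hσ
  set V : ℝ≥0 → Ω → EuclideanSpace ℝ (Fin 2) := fun t ω => reflect σ (W t ω) with hVdef
  have hocc : ∀ i j, (∀ x, reflect σ x ∈ quadrant i ↔ x ∈ quadrant j) →
      occTime V i = occTime W j := fun i j hij => by
    ext ω
    unfold occTime
    congr 1
    ext t
    by_cases hm : W t.toNNReal ω ∈ quadrant j
    · rw [indicator_of_mem hm, indicator_of_mem (by exact (hij _).2 hm)]
    · rw [indicator_of_notMem hm, indicator_of_notMem (by exact fun h => hm ((hij _).1 h))]
  have hocck := hocc 2 k hk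
  set ε : ℝ := min (1 / 4) (1 / (2 * C)) with hεdef
  have hε : 0 < ε := by positivity
  have hε1 : 4 * ε ≤ 1 := by linarith [min_le_left (1 / 4 : ℝ) (1 / (2 * C))]
  have hε2 : C * ε ≤ 1 / 2 := by
    calc C * ε ≤ C * (1 / (2 * C)) := by gcongr; exact min_le_right _ _
      _ = 1 / 2 := by field_simp
  obtain ⟨hpos, hle⟩ := h V hV ε hε hε1
  set A := smallTimes V ε with hA
  have hposr : 0 < P.real A := ENNReal.toReal_pos hpos.ne' (measure_ne_top _ _)
  have hAm : MeasurableSet[occSigma W] A := by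
    have : A = ⋂ i, ⋂ (_ : i ≠ 0), occTime V i ⁻¹' Icc ε (2 * ε) := by
      ext ω; simp [hA, smallTimes]
    rw [this]
    refine MeasurableSet.iInter fun i => MeasurableSet.iInter fun _ => ?_
    obtain ⟨j, hj⟩ := hquad i
    rw [hocc i j hj]
    exact ⟨(fun y : Fin 4 → ℝ => y j) ⁻¹' Icc ε (2 * ε),
      measurableSet_Icc.preimage (measurable_pi_apply j), rfl⟩
  have hB : MeasurableSet {ω | W 1 ω ∈ quadrant k} :=
    (measurableSet_quadrant k).preimage (hW.measurable.comp measurable_prodMk_left)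
  have hBV : {ω | W 1 ω ∈ quadrant k} = {ω | V 1 ω ∈ quadrant 2} := by
    ext ω; exact (hk _).symm
  have hint : Integrable ({ω | W 1 ω ∈ quadrant k}.indicator fun _ => (1 : ℝ)) P :=
    (integrable_const 1).indicator hB
  have hset := setIntegral_condExp hW.occSigma_le hint hAm
  have hA' := hV.measurableSet_smallTimes ε
  have hocci : Integrable (occTime W k) P := integrable_condExp.congr heq
  have hlow : ε * P.real A ≤ ∫ ω in A, occTime W k ω ∂P :=
    setIntegral_ge_of_const_le_real hA' (measure_ne_top _ _)
      (fun ω hω => hocck ▸ (hω 2 (by decide)).1) hocci.integrableOn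
  rw [setIntegral_congr_ae hA' (heq.mono fun ω hω _ => hω), integral_indicator hB,
    Measure.restrict_restrict hB, setIntegral_const, smul_eq_mul, mul_one, inter_comm, hBV] at hset
  rw [hset] at hlow
  have hfin := hlow.trans hle
  have : ε * P.real A * (C * ε) ≤ ε * P.real A * (1 / 2) := by gcongr
  have hεA : 0 < ε * P.real A := by positivity
  nlinarith

theorem proposition4p1 :
    ∃ C > (0 : ℝ), ∃ ε₀ ∈ Ioo (0 : ℝ) 1,
      ∀ (Ω : Type*) [MeasurableSpace Ω] (P : Measure Ω) [IsProbabilityMeasure P]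
        (W : ℝ≥0 → Ω → EuclideanSpace ℝ (Fin 2)), IsPlanarBrownian W P →
        (∀ k : Fin 4,
          ¬ (P⟦{ω | W 1 ω ∈ quadrant k} | occSigma W⟧ =ᵐ[P] occTime W k)) ∧
        (∀ ε ∈ Ioo (0 : ℝ) ε₀,
          0 < P (smallTimes W ε) ∧
          (P[|smallTimes W ε]).real {ω | W 1 ω ∈ quadrant 2} ≤
            C * ε ^ 2 * Real.log (1 / ε) ^ 3) := by
  obtain ⟨C, hC, h⟩ := exists_measure_smallTimes_inter_le
  refine ⟨C, hC, Real.exp (-2), ⟨Real.exp_pos _, by simp⟩, fun Ω _ P _ W hW =>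
    ⟨not_condExp_ae_eq_occTime hC hW (h Ω P), fun ε hε => ?_⟩⟩
  have hlog : 2 ≤ Real.log (1 / ε) := by
    rw [one_div, Real.log_inv]
    linarith [(Real.log_lt_iff_lt_exp hε.1).2 hε.2]
  have hε1 : 4 * ε ≤ 1 := by
    have h3 : (4 : ℝ) ≤ Real.exp 2 := by
      have := Real.add_one_le_exp (1 : ℝ)
      rw [show (2 : ℝ) = 1 + 1 by norm_num, Real.exp_add]
      nlinarith
    have h4 : ε * Real.exp 2 ≤ 1 := by
      calc ε * Real.exp 2 ≤ Real.exp (-2) * Real.exp 2 := by gcongr; exact hε.2.le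
        _ = 1 := by rw [← Real.exp_add]; simp
    nlinarith [hε.1]
  obtain ⟨hpos, hle⟩ := h Ω P W hW ε hε.1 hε1
  refine ⟨hpos, ?_⟩
  have hposr : 0 < P.real (smallTimes W ε) := ENNReal.toReal_pos hpos.ne' (measure_ne_top _ _)
  rw [measureReal_def, cond_apply (hW.measurableSet_smallTimes ε), ENNReal.toReal_mul,
    ENNReal.toReal_inv, ← measureReal_def, ← measureReal_def, inv_mul_le_iff₀ hposr]
  refine hle.trans ?_
  rw [mul_comm (P.real (smallTimes W ε))]
  refine mul_le_mul_of_nonneg_right ?_ hposr.le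
  exact le_mul_of_one_le_right (by positivity) (one_le_pow₀ (by linarith))
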